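/- A derangement of $n$ symbols is a permutation of $\{1,\dots,n\}$ without fixed points. For $n\ge 2$ choose a derangement of $n$ symbols uniformly at random and let $S_n$ be the length of its shortest cycle; write ${}_S\mu_n=\mathbb{E}[S_n]$ and ${}_S\sigma_n^2=\operatorname{Var}(S_n)$. Let $\gamma$ be the Euler–Mascheroni constant, let $E(x)=\int_x^\infty \frac{e^{-t}}{t}\,dt$ for $x>0$, and for integers $h\ge 2$ put $$G(h)=\frac{1}{(h-1)!}\int_0^\infty x^{h-1}\exp\left[E(x)-x\right]dx .$$ Then $$\lim_{n\to\infty}\frac{{}_S\mu_n}{\ln n}=e^{1-\gamma}.$$ Moreover, for every integer $h\ge 2$ the integral defining $G(h)$ converges and $$\lim_{n\to\infty}\frac{\mathbb{E}[S_n^h]}{n^{h-1}}=e\cdot G(h),$$ and in particular $$\lim_{n\to\infty}\frac{{}_S\sigma_n^2}{n}=e\cdot G(2).$$ -/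

import Mathlib

/-- The length of the shortest cycle of a permutation of `n` symbols. The parts of
`σ.partition` are the lengths of all cycles of `σ`, a fixed point counting as a cycle of
length `1`. (For `n = 0` there is no cycle and the value is `0`.) -/
noncomputable def shortestCycle {n : ℕ} (σ : Equiv.Perm (Fin n)) : ℕ :=
  sInf {k : ℕ | k ∈ σ.partition.parts}

/-- The expectation of `f` under the uniform distribution on the derangements of `n`
symbols. (For `n = 1` there is no derangement and the value is `0`.) -/
noncomputable def derangementMean (n : ℕ) (f : Equiv.Perm (Fin n) → ℝ) : ℝ :=
  (∑ σ : derangements (Fin n), f σ) / (Fintype.card (derangements (Fin n)) : ℝ)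

/-- The `h`-th moment of the shortest cycle length of a random derangement of `n` symbols. -/
noncomputable def shortestCycleMoment (h n : ℕ) : ℝ :=
  derangementMean n fun σ => (shortestCycle σ : ℝ) ^ h

/-- The variance of the shortest cycle length of a random derangement of `n` symbols. -/
noncomputable def shortestCycleVariance (n : ℕ) : ℝ :=
  derangementMean n fun σ => ((shortestCycle σ : ℝ) - shortestCycleMoment 1 n) ^ 2

/-- The exponential integral `E(x) = ∫_x^∞ e^{-t} / t dt`, for `x > 0`. -/
noncomputable def expIntegral (x : ℝ) : ℝ :=
  ∫ t in Set.Ioi x, Real.exp (-t) / t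

/-- The constant `1 / (h-1)! * ∫_0^∞ x^{h-1} exp (E(x) - x) dx`, for `h ≥ 2`. -/
noncomputable def shortestCycleConst (h : ℕ) : ℝ :=
  1 / ((h - 1).factorial : ℝ) *
    ∫ x in Set.Ioi (0 : ℝ), x ^ (h - 1) * Real.exp (expIntegral x - x)

/-!
Let `p_m(n)` be the proportion of permutations of `n` symbols all of whose cycles have length at
least `m`. Splitting off the cycle through a given symbol yields
`n p_m(n) = ∑_{j ≤ n - m} p_m(j)`, and summation by parts turns the moments of the shortest cycle
of a derangement into weighted sums of the `p_m(n)` over `m`, divided by the proportion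
`p_2(n) → 1 / e` of derangements.

For fixed `m` the generating function `exp (-∑_{i < m} x^i / i) / (1 - x)` gives
`p_m(n) → exp (-H_{m-1}) ~ e^{-γ} / m`, with an error small enough to be summed over `m ≤ n`; this
yields `∑_m p_m(n) ~ e^{-γ} log n`. For `m ~ y n` the recurrence is a Riemann sum for the integral
equation of Buchstab's function `ω`, so that `n p_m(n) → ω(1 / y) / y`, and the higher moments
become integrals of `ω`. Finally the Laplace transform `L` of `ω` on `u > 1` satisfies
`1 + L(s) = exp (E(s))`, which turns these integrals into the constants `G(h)`.
-/

open Filter Topology MeasureTheory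
open scoped Nat

/-! ### The proportion of permutations without short cycles -/

/-- The probability that a uniform random permutation of `n` symbols has no cycle of length less
than `m`, written `p_m(n)` below. -/
noncomputable def longCycleProb (m n : ℕ) : ℝ :=
  ({σ : Equiv.Perm (Fin n) | ∀ i ∈ σ.partition.parts, m ≤ i} : Finset _).card / n !

theorem longCycleProb_nonneg (m n : ℕ) : 0 ≤ longCycleProb m n := by
  unfold longCycleProb
  positivity

theorem longCycleProb_le_one (m n : ℕ) : longCycleProb m n ≤ 1 := by
  refine div_le_one_of_le₀ ?_ (by positivity)
  simpa [Fintype.card_perm] using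
    Finset.card_le_univ ({σ : Equiv.Perm (Fin n) | ∀ i ∈ σ.partition.parts, m ≤ i} : Finset _)

theorem longCycleProb_eq_one {m n : ℕ}
    (h : ∀ σ : Equiv.Perm (Fin n), ∀ i ∈ σ.partition.parts, m ≤ i) : longCycleProb m n = 1 := by
  rw [longCycleProb, Finset.filter_true_of_mem fun σ _ => h σ, Finset.card_univ,
    Fintype.card_perm, Fintype.card_fin, div_self (by positivity)]

theorem longCycleProb_zero_right (m : ℕ) : longCycleProb m 0 = 1 :=
  longCycleProb_eq_one fun σ _ hi =>
    absurd (σ.partition.parts_pos hi) (by simpa using Nat.Partition.le_of_mem_parts hi)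

theorem longCycleProb_one_left (n : ℕ) : longCycleProb 1 n = 1 :=
  longCycleProb_eq_one fun σ _ hi => σ.partition.parts_pos hi

/-- The probability `1 / ∏ i, i ^ cᵢ * cᵢ!`, with `cᵢ` the multiplicity of `i` in `s`, that a random
permutation of `s.sum` symbols has cycle type `s`. -/
noncomputable def cycleWeight (s : Multiset ℕ) : ℝ :=
  ((s.prod * ∏ i ∈ s.toFinset, (s.count i)! : ℕ) : ℝ)⁻¹

theorem prod_count_factorial_cons (i : ℕ) (s : Multiset ℕ) :
    ∏ j ∈ (i ::ₘ s).toFinset, ((i ::ₘ s).count j)! =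
      (s.count i + 1) * ∏ j ∈ s.toFinset, (s.count j)! := by
  have hrest : ∏ j ∈ s.toFinset.erase i, ((i ::ₘ s).count j)! =
      ∏ j ∈ s.toFinset.erase i, (s.count j)! :=
    Finset.prod_congr rfl fun j hj => by
      rw [Multiset.count_cons_of_ne (Finset.ne_of_mem_erase hj)]
  rw [Multiset.toFinset_cons, ← Finset.mul_prod_erase _ _ (Finset.mem_insert_self _ _),
    Finset.erase_insert_eq_erase, hrest, Multiset.count_cons_self, Nat.factorial_succ, mul_assoc]
  congr 1
  by_cases hi : i ∈ s
  · exact Finset.mul_prod_erase _ (fun j => (s.count j)!) (Multiset.mem_toFinset.2 hi)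
  · rw [Multiset.count_eq_zero_of_notMem hi, Nat.factorial_zero, one_mul,
      Finset.erase_eq_of_notMem (by simpa using hi)]

theorem count_mul_cycleWeight {i : ℕ} (hi : 0 < i) {s : Multiset ℕ} (his : i ∈ s) :
    (s.count i * i : ℝ) * cycleWeight s = cycleWeight (s.erase i) := by
  obtain ⟨t, rfl⟩ := Multiset.exists_cons_of_mem his
  rw [Multiset.erase_cons_head, cycleWeight, cycleWeight, prod_count_factorial_cons,
    Multiset.prod_cons, Multiset.count_cons_self]
  push_cast
  field_simp

/-- The partitions of `n` into parts at least `m`, as multisets. -/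
def partitionsGE (m n : ℕ) : Finset (Multiset ℕ) :=
  (Nat.Partition.restricted n (m ≤ ·)).image Nat.Partition.parts

theorem mem_partitionsGE {m n : ℕ} (hm : 0 < m) {s : Multiset ℕ} :
    s ∈ partitionsGE m n ↔ s.sum = n ∧ ∀ i ∈ s, m ≤ i := by
  simp only [partitionsGE, Nat.Partition.restricted, Finset.mem_image, Finset.mem_filter_univ]
  constructor
  · rintro ⟨p, hp, rfl⟩
    exact ⟨p.parts_sum, hp⟩
  · rintro ⟨hsum, hs⟩
    exact ⟨⟨s, fun {i} hi => hm.trans_le (hs i hi), hsum⟩, hs, rfl⟩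

theorem mul_sum_cycleWeight {m : ℕ} (hm : 0 < m) (n : ℕ) :
    n * ∑ s ∈ partitionsGE m n, cycleWeight s =
      ∑ s ∈ partitionsGE m n, ∑ i ∈ s.toFinset, cycleWeight (s.erase i) := by
  rw [Finset.mul_sum]
  refine Finset.sum_congr rfl fun s hs => ?_
  rw [mem_partitionsGE hm] at hs
  have hn : (n : ℝ) = ∑ i ∈ s.toFinset, (s.count i * i : ℝ) := by
    rw [← hs.1, Finset.sum_multiset_count]
    push_cast [smul_eq_mul]
    rfl
  rw [hn, Finset.sum_mul]
  refine Finset.sum_congr rfl fun i hi => ?_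
  rw [Multiset.mem_toFinset] at hi
  exact count_mul_cycleWeight (hm.trans_le (hs.2 i hi)) hi

theorem sum_partitionsGE_erase {M : Type*} [AddCommMonoid M] {m : ℕ} (hm : 0 < m) (n : ℕ)
    (w : Multiset ℕ → M) :
    ∑ s ∈ partitionsGE m n, ∑ i ∈ s.toFinset, w (s.erase i) =
      ∑ j ∈ Finset.range (n + 1 - m), ∑ t ∈ partitionsGE m j, w t := by
  rw [Finset.sum_sigma', Finset.sum_sigma']
  refine Finset.sum_bij' (fun x _ => ⟨n - x.2, x.1.erase x.2⟩)
    (fun y _ => ⟨(n - y.1) ::ₘ y.2, n - y.1⟩) ?_ ?_ ?_ ?_ fun _ _ => rfl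
  · rintro ⟨s, i⟩ h
    simp only [Finset.mem_sigma, Multiset.mem_toFinset, mem_partitionsGE hm,
      Finset.mem_range] at h ⊢
    obtain ⟨⟨hsum, hs⟩, hi⟩ := h
    obtain ⟨t, rfl⟩ := Multiset.exists_cons_of_mem hi
    rw [Multiset.sum_cons] at hsum
    have := hs i hi
    rw [Multiset.erase_cons_head]
    exact ⟨by omega, by omega, fun j hj => hs j (Multiset.mem_cons_of_mem hj)⟩
  · rintro ⟨j, t⟩ h
    simp only [Finset.mem_sigma, Multiset.mem_toFinset, mem_partitionsGE hm, Finset.mem_range,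
      Multiset.sum_cons, Multiset.mem_cons, forall_eq_or_imp, true_or, and_true] at h ⊢
    obtain ⟨hj, hsum, ht⟩ := h
    exact ⟨by omega, by omega, ht⟩
  · rintro ⟨s, i⟩ h
    simp only [Finset.mem_sigma, Multiset.mem_toFinset, mem_partitionsGE hm] at h
    obtain ⟨⟨hsum, -⟩, hi⟩ := h
    have hin : n - (n - i) = i := Nat.sub_sub_self (hsum ▸ Multiset.le_sum_of_mem hi)
    simp only [hin, Multiset.cons_erase hi]
  · rintro ⟨j, t⟩ h
    simp only [Finset.mem_sigma, Finset.mem_range] at h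
    simp only [Multiset.erase_cons_head, Sigma.mk.injEq, heq_eq_eq, and_true]
    omega

theorem parts_partition_eq_cycleType {n : ℕ} {σ : Equiv.Perm (Fin n)}
    (hσ : ∀ i ∈ σ.partition.parts, 2 ≤ i) : σ.partition.parts = σ.cycleType := by
  rw [← σ.filter_parts_partition_eq_cycleType, Multiset.filter_eq_self.2 hσ]

theorem card_cycleType_eq_mul_cycleWeight {s : Multiset ℕ} (hs : ∀ i ∈ s, 2 ≤ i) :
    (({σ : Equiv.Perm (Fin s.sum) | σ.cycleType = s} : Finset _).card : ℝ) =
      s.sum ! * cycleWeight s := by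
  have hcard := Equiv.Perm.card_of_cycleType_mul_eq (Fin s.sum) s
  rw [Fintype.card_fin, if_pos ⟨le_rfl, hs⟩, Nat.sub_self, Nat.factorial_zero, one_mul] at hcard
  have hprod : 0 < s.prod := Multiset.prod_pos fun i hi => two_pos.trans_le (hs i hi)
  rw [cycleWeight, ← hcard, Nat.cast_mul, mul_assoc, mul_inv_cancel₀ (by positivity), mul_one]

theorem longCycleProb_eq_sum_cycleWeight {m : ℕ} (hm : 2 ≤ m) (n : ℕ) :
    longCycleProb m n = ∑ s ∈ partitionsGE m n, cycleWeight s := by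
  have hm0 : 0 < m := two_pos.trans_le hm
  have hmaps : ∀ σ ∈ ({σ | ∀ i ∈ σ.partition.parts, m ≤ i} : Finset (Equiv.Perm (Fin n))),
      σ.partition.parts ∈ partitionsGE m n := fun σ hσ =>
    (mem_partitionsGE hm0).2
      ⟨σ.partition.parts_sum.trans (Fintype.card_fin n), (Finset.mem_filter_univ _).1 hσ⟩
  rw [longCycleProb, Finset.card_eq_sum_card_fiberwise hmaps, Nat.cast_sum, Finset.sum_div]
  refine Finset.sum_congr rfl fun s hs => ?_
  obtain ⟨rfl, hms⟩ := (mem_partitionsGE hm0).1 hs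
  rw [div_eq_iff (by positivity), mul_comm,
    ← card_cycleType_eq_mul_cycleWeight fun i hi => hm.trans (hms i hi), Finset.filter_filter]
  congr 2
  ext σ
  simp only [Finset.mem_filter_univ]
  constructor
  · rintro ⟨hσ, hparts⟩
    exact (parts_partition_eq_cycleType fun i hi => hm.trans (hσ i hi)).symm.trans hparts
  · intro hσ
    have hparts : σ.partition.parts = s := by
      rw [Equiv.Perm.parts_partition, ← Equiv.Perm.sum_cycleType, hσ, Fintype.card_fin,
        Nat.sub_self, Multiset.replicate_zero, add_zero]
    exact ⟨by rwa [hparts], hparts⟩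

/- The term with index `j` accounts for the permutations in which a given symbol lies in a cycle
of length `n - j`. -/
theorem mul_longCycleProb {m : ℕ} (hm : 0 < m) (n : ℕ) :
    n * longCycleProb m n = ∑ j ∈ Finset.range (n + 1 - m), longCycleProb m j := by
  obtain rfl | hm2 : m = 1 ∨ 2 ≤ m := by omega
  · simp [longCycleProb_one_left]
  · simp_rw [longCycleProb_eq_sum_cycleWeight hm2]
    rw [mul_sum_cycleWeight hm, sum_partitionsGE_erase hm]

/-! ### The shortest cycle of a random derangement -/

theorem exists_mem_parts_partition {n : ℕ} (hn : 0 < n) (σ : Equiv.Perm (Fin n)) :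
    ∃ i, i ∈ σ.partition.parts := by
  refine Multiset.exists_mem_of_ne_zero fun h => ?_
  simpa [h, hn.ne] using σ.partition.parts_sum

theorem le_shortestCycle_iff {n : ℕ} (hn : 0 < n) (σ : Equiv.Perm (Fin n)) (m : ℕ) :
    m ≤ shortestCycle σ ↔ ∀ i ∈ σ.partition.parts, m ≤ i :=
  ⟨fun h _ hi => h.trans (Nat.sInf_le hi),
    fun h => h _ (Nat.sInf_mem (exists_mem_parts_partition hn σ))⟩

theorem shortestCycle_le {n : ℕ} (hn : 0 < n) (σ : Equiv.Perm (Fin n)) : shortestCycle σ ≤ n := by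
  obtain ⟨i, hi⟩ := exists_mem_parts_partition hn σ
  exact (Nat.sInf_le hi).trans (by simpa using Nat.Partition.le_of_mem_parts hi)

theorem shortestCycle_pos {n : ℕ} (hn : 0 < n) (σ : Equiv.Perm (Fin n)) : 0 < shortestCycle σ :=
  (le_shortestCycle_iff hn σ 1).2 fun _ hi => σ.partition.parts_pos hi

theorem mem_derangements_iff_two_le_shortestCycle {n : ℕ} (hn : 0 < n) (σ : Equiv.Perm (Fin n)) :
    σ ∈ derangements (Fin n) ↔ 2 ≤ shortestCycle σ := by
  have hsupport : σ ∈ derangements (Fin n) ↔ σ.support.card = n := by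
    have hcard := Finset.card_eq_iff_eq_univ σ.support
    rw [Fintype.card_fin] at hcard
    simp only [hcard, Finset.eq_univ_iff_forall, Equiv.Perm.mem_support]
    rfl
  rw [hsupport, le_shortestCycle_iff hn, Equiv.Perm.parts_partition, Fintype.card_fin]
  constructor
  · intro h i hi
    rw [h, Nat.sub_self, Multiset.replicate_zero, add_zero] at hi
    exact Equiv.Perm.two_le_of_mem_cycleType hi
  · intro h
    have hle : σ.support.card ≤ n := by simpa using σ.support.card_le_univ
    by_contra hne
    have := h 1 (Multiset.mem_add.2 (Or.inr (Multiset.mem_replicate.2 ⟨by omega, rfl⟩)))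
    omega

theorem card_le_shortestCycle {n : ℕ} (hn : 0 < n) (m : ℕ) :
    (({σ : Equiv.Perm (Fin n) | m ≤ shortestCycle σ} : Finset _).card : ℝ) =
      n ! * longCycleProb m n := by
  simp_rw [le_shortestCycle_iff hn, longCycleProb]
  rw [mul_div_cancel₀ _ (by positivity)]

theorem sum_derangements {M : Type*} [AddCommMonoid M] {n : ℕ} (hn : 0 < n)
    (f : Equiv.Perm (Fin n) → M) :
    ∑ σ : derangements (Fin n), f σ = ∑ σ with 2 ≤ shortestCycle σ, f σ :=
  (Finset.sum_subtype _
    (fun σ => by simp [mem_derangements_iff_two_le_shortestCycle hn]) f).symm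

theorem card_derangements_eq_mul_longCycleProb {n : ℕ} (hn : 0 < n) :
    (Fintype.card (derangements (Fin n)) : ℝ) = n ! * longCycleProb 2 n := by
  rw [← card_le_shortestCycle hn, ← Finset.card_univ, Finset.card_eq_sum_ones,
    sum_derangements hn fun _ => 1, Finset.card_eq_sum_ones]

theorem sum_comp_eq_sum_range_mul_card {ι R : Type*} [Ring R] {s : Finset ι} {f : ι → ℕ} {n : ℕ}
    (hf : ∀ x ∈ s, f x ≤ n) {g : ℕ → R} (hg : g 0 = 0) :
    ∑ x ∈ s, g (f x) =
      ∑ i ∈ Finset.range n, (g (i + 1) - g i) * ({x ∈ s | i < f x} : Finset ι).card := by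
  have hlayer : ∀ x ∈ s, g (f x) = ∑ i ∈ Finset.range n with i < f x, (g (i + 1) - g i) := by
    intro x hx
    have hfilter : ({i ∈ Finset.range n | i < f x} : Finset ℕ) = Finset.range (f x) := by
      have := hf x hx
      ext i
      simp only [Finset.mem_filter, Finset.mem_range]
      omega
    rw [hfilter, Finset.sum_range_sub, hg, sub_zero]
  rw [Finset.sum_congr rfl hlayer]
  simp_rw [Finset.sum_filter]
  rw [Finset.sum_comm]
  refine Finset.sum_congr rfl fun i _ => ?_
  rw [← Finset.sum_filter, Finset.sum_const, nsmul_eq_mul, Nat.cast_comm]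

theorem sum_shortestCycle_pow {h n : ℕ} (hh : 0 < h) (hn : 0 < n) :
    ∑ σ : Equiv.Perm (Fin n), (shortestCycle σ : ℝ) ^ h =
      n ! * ∑ i ∈ Finset.range n, (((i : ℝ) + 1) ^ h - (i : ℝ) ^ h) * longCycleProb (i + 1) n := by
  have := sum_comp_eq_sum_range_mul_card (s := Finset.univ) (fun σ _ => shortestCycle_le hn σ)
    (g := fun i => (i : ℝ) ^ h) (by simp [hh.ne'])
  rw [this, Finset.mul_sum]
  refine Finset.sum_congr rfl fun i _ => ?_
  simp only [Nat.lt_iff_add_one_le, card_le_shortestCycle hn, Nat.cast_add_one]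
  ring

/- Permutations that are not derangements have shortest cycle `1`, so that their contribution to
the sum over all permutations is their number. -/
theorem shortestCycleMoment_eq {h n : ℕ} (hh : 0 < h) (hn : 0 < n) :
    shortestCycleMoment h n = (∑ i ∈ Finset.range n,
      (((i : ℝ) + 1) ^ h - (i : ℝ) ^ h) * longCycleProb (i + 1) n - (1 - longCycleProb 2 n)) /
        longCycleProb 2 n := by
  have hsplit := Finset.sum_filter_add_sum_filter_not Finset.univ
    (fun σ : Equiv.Perm (Fin n) => 2 ≤ shortestCycle σ) fun σ => (shortestCycle σ : ℝ) ^ h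
  have hcard := Finset.sum_filter_add_sum_filter_not Finset.univ
    (fun σ : Equiv.Perm (Fin n) => 2 ≤ shortestCycle σ) fun _ => (1 : ℝ)
  have hone : ∑ σ : Equiv.Perm (Fin n) with ¬ 2 ≤ shortestCycle σ, (shortestCycle σ : ℝ) ^ h =
      ∑ σ : Equiv.Perm (Fin n) with ¬ 2 ≤ shortestCycle σ, (1 : ℝ) := by
    refine Finset.sum_congr rfl fun σ hσ => ?_
    have : shortestCycle σ = 1 := by
      have := shortestCycle_pos hn σ
      have := (Finset.mem_filter_univ _).1 hσ
      omega
    rw [this, Nat.cast_one, one_pow]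
  have hfact : (n ! : ℝ) ≠ 0 := by positivity
  simp only [Finset.sum_const, nsmul_one, card_le_shortestCycle hn, Finset.card_univ,
    Fintype.card_perm, Fintype.card_fin] at hcard hone
  rw [sum_shortestCycle_pow hh hn, hone, ← eq_sub_iff_add_eq] at hsplit
  rw [shortestCycleMoment, derangementMean, card_derangements_eq_mul_longCycleProb hn,
    sum_derangements hn fun σ => (shortestCycle σ : ℝ) ^ h, hsplit,
    ← mul_div_mul_left _ (longCycleProb 2 n) hfact]
  congr 1
  linarith

theorem shortestCycleVariance_eq {n : ℕ} (hn : (derangements (Fin n)).Nonempty) :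
    shortestCycleVariance n = shortestCycleMoment 2 n - shortestCycleMoment 1 n ^ 2 := by
  have : Nonempty (derangements (Fin n)) := hn.to_subtype
  have hcard : (Fintype.card (derangements (Fin n)) : ℝ) ≠ 0 := by positivity
  have hmean : ∑ σ : derangements (Fin n), (shortestCycle (σ : Equiv.Perm (Fin n)) : ℝ) =
      shortestCycleMoment 1 n * Fintype.card (derangements (Fin n)) := by
    rw [shortestCycleMoment, derangementMean, div_mul_cancel₀ _ hcard]
    simp only [pow_one]
  rw [shortestCycleVariance, derangementMean, shortestCycleMoment.eq_1 2, derangementMean,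
    eq_sub_iff_add_eq, div_add' _ _ _ hcard]
  congr 1
  simp only [sub_sq]
  rw [Finset.sum_add_distrib, Finset.sum_sub_distrib, ← Finset.sum_mul, ← Finset.mul_sum, hmean,
    Finset.sum_const, Finset.card_univ, nsmul_eq_mul]
  ring

/-! ### Bounds from the recurrence -/

section Recurrence

variable {m n : ℕ}

theorem longCycleProb_of_lt (hn : 0 < n) (hnm : n < m) : longCycleProb m n = 0 := by
  have hrec := mul_longCycleProb (hn.trans hnm) n
  rw [Nat.sub_eq_zero_of_le hnm, Finset.sum_range_zero] at hrec
  exact (mul_eq_zero.1 hrec).resolve_left (by positivity)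

theorem longCycleProb_le_inv (hm : 0 < m) (hn : 0 < n) : longCycleProb m n ≤ (m : ℝ)⁻¹ := by
  induction n using Nat.strong_induction_on with
  | _ n ih =>
    rcases lt_or_ge n m with hnm | hmn
    · rw [longCycleProb_of_lt hn hnm]
      positivity
    · have hsum : ∑ j ∈ Finset.range (n - m), longCycleProb m (j + 1) ≤
          ∑ _j ∈ Finset.range (n - m), (m : ℝ)⁻¹ := by
        refine Finset.sum_le_sum fun j hj => ih _ ?_ j.succ_pos
        rw [Finset.mem_range] at hj
        omega
      rw [Finset.sum_const, Finset.card_range, nsmul_eq_mul, Nat.cast_sub hmn] at hsum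
      refine le_of_mul_le_mul_left ?_ (Nat.cast_pos.2 hn)
      calc (n : ℝ) * longCycleProb m n
          = ∑ j ∈ Finset.range (n - m), longCycleProb m (j + 1) + 1 := by
            rw [mul_longCycleProb hm, Nat.sub_add_comm hmn, Finset.sum_range_succ',
              longCycleProb_zero_right]
        _ ≤ (n - m) * (m : ℝ)⁻¹ + 1 := by gcongr
        _ = n * (m : ℝ)⁻¹ := by field_simp; ring

theorem add_one_mul_longCycleProb_succ_sub (hm : 0 < m) (hmn : m ≤ n + 1) :
    ((n : ℝ) + 1) * (longCycleProb m (n + 1) - longCycleProb m n) =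
      longCycleProb m (n + 1 - m) - longCycleProb m n := by
  have hrec := mul_longCycleProb hm (n + 1)
  rw [Nat.sub_add_comm hmn, Finset.sum_range_succ, ← mul_longCycleProb hm] at hrec
  push_cast at hrec
  linear_combination hrec

theorem dist_longCycleProb_succ (hm : 0 < m) (hmn : m ≤ n + 1) :
    dist (longCycleProb m n) (longCycleProb m (n + 1)) =
      dist (longCycleProb m (n + 1 - m)) (longCycleProb m n) / (n + 1) := by
  rw [dist_comm, Real.dist_eq, Real.dist_eq, ← add_one_mul_longCycleProb_succ_sub hm hmn, abs_mul,
    abs_of_pos (show (0 : ℝ) < n + 1 by positivity), mul_div_cancel_left₀ _ (by positivity)]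

theorem dist_longCycleProb_succ_le_inv (hm : 0 < m) (hmn : m ≤ n) :
    dist (longCycleProb m n) (longCycleProb m (n + 1)) ≤ (m : ℝ)⁻¹ / (n + 1) := by
  rw [dist_longCycleProb_succ hm (by omega)]
  gcongr
  exact abs_sub_le_of_nonneg_of_le (longCycleProb_nonneg _ _)
    (longCycleProb_le_inv hm (by omega)) (longCycleProb_nonneg _ _)
    (longCycleProb_le_inv hm (by omega))

/- For `2 * m < n + 1` the increments between `n + 1 - m` and `n` are all at most
`2 / (m * (n + 1))`, and there are fewer than `m` of them. -/
theorem dist_longCycleProb_succ_le_sq (hm : 0 < m) (hmn : m ≤ n) :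
    dist (longCycleProb m n) (longCycleProb m (n + 1)) ≤ 2 / ((n : ℝ) + 1) ^ 2 := by
  have hm' : (0 : ℝ) < m := Nat.cast_pos.2 hm
  have hinv {i : ℕ} (hi : n + 1 ≤ 2 * (i + 1)) : ((i : ℝ) + 1)⁻¹ ≤ 2 / (n + 1) := by
    rw [inv_le_comm₀ (by positivity) (by positivity), inv_div, div_le_iff₀' two_pos]
    exact_mod_cast hi
  rcases le_or_gt (n + 1) (2 * m) with hle | hlt
  · refine (dist_longCycleProb_succ_le_inv hm hmn).trans ?_
    rw [sq, ← div_div]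
    gcongr
    obtain ⟨k, rfl⟩ := Nat.exists_eq_add_one.2 hm
    exact_mod_cast hinv hle
  · have hstep : ∀ {i}, n + 1 - m ≤ i → i < n →
        dist (longCycleProb m i) (longCycleProb m (i + 1)) ≤ (m : ℝ)⁻¹ * (2 / (n + 1)) := by
      intro i hi _
      refine (dist_longCycleProb_succ_le_inv hm (by omega)).trans ?_
      rw [div_eq_mul_inv]
      gcongr
      exact hinv (by omega)
    have hdist := dist_le_Ico_sum_of_dist_le (show n + 1 - m ≤ n by omega) hstep
    rw [dist_longCycleProb_succ hm (by omega), sq, ← div_div]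
    gcongr
    refine hdist.trans ?_
    rw [Finset.sum_const, Nat.card_Ico, nsmul_eq_mul, ← mul_assoc]
    refine mul_le_of_le_one_left (by positivity) ?_
    rw [← div_eq_mul_inv, div_le_one hm']
    exact_mod_cast show n - (n + 1 - m) ≤ m by omega

end Recurrence

/-! ### The limit of `p_m(n)` for fixed `m` -/

theorem powerSeries_ext_of_derivative_eq_mul {R : Type*} [CommRing R] [IsAddTorsionFree R]
    {c f g : PowerSeries R} (hf : PowerSeries.derivative R f = c * f)
    (hg : PowerSeries.derivative R g = c * g)
    (h0 : PowerSeries.constantCoeff f = PowerSeries.constantCoeff g) : f = g := by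
  ext n
  induction n using Nat.strong_induction_on with
  | _ n ih =>
    rcases n with - | n
    · simpa using h0
    · have hcoeff : PowerSeries.coeff n (c * f) = PowerSeries.coeff n (c * g) := by
        rw [PowerSeries.coeff_mul, PowerSeries.coeff_mul]
        refine Finset.sum_congr rfl fun x hx => ?_
        rw [ih x.2 (Nat.lt_succ_of_le (Finset.HasAntidiagonal.antidiagonal.snd_le hx))]
      rw [← hf, ← hg, PowerSeries.coeff_derivative, PowerSeries.coeff_derivative] at hcoeff
      have hsmul : (n + 1) • PowerSeries.coeff (n + 1) f =
          (n + 1) • PowerSeries.coeff (n + 1) g := by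
        simpa [nsmul_eq_mul, mul_comm] using hcoeff
      exact nsmul_right_injective n.succ_ne_zero hsmul

theorem derivative_mk_longCycleProb (m : ℕ) :
    PowerSeries.derivative ℝ (PowerSeries.mk (longCycleProb (m + 1))) =
      PowerSeries.X ^ m * PowerSeries.mk 1 * PowerSeries.mk (longCycleProb (m + 1)) := by
  ext n
  rw [PowerSeries.coeff_derivative, PowerSeries.coeff_mk, mul_comm, mul_assoc,
    PowerSeries.coeff_X_pow_mul']
  have hrec := mul_longCycleProb m.succ_pos (n + 1)
  rw [Nat.succ_eq_add_one, Nat.add_sub_add_right, Nat.cast_add_one] at hrec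
  rw [hrec]
  split_ifs with hmn
  · rw [mul_comm, PowerSeries.coeff_mul, Finset.Nat.sum_antidiagonal_eq_sum_range_succ_mk,
      Nat.succ_eq_add_one, ← Nat.sub_add_comm hmn]
    simp only [PowerSeries.coeff_mk, Pi.one_apply, mul_one]
  · rw [Nat.sub_eq_zero_of_le (by omega), Finset.sum_range_zero]

/-- The power series of `exp (-x ^ m / m)`. -/
noncomputable def expNegPowDiv (m : ℕ) (hm : m ≠ 0) : PowerSeries ℝ :=
  PowerSeries.expand m hm (PowerSeries.rescale (-(m : ℝ)⁻¹) (PowerSeries.exp ℝ))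

theorem derivative_rescale {R : Type*} [CommRing R] (a : R) (f : PowerSeries R) :
    PowerSeries.derivative R (PowerSeries.rescale a f) =
      a • PowerSeries.rescale a (PowerSeries.derivative R f) := by
  ext n
  simp only [PowerSeries.coeff_derivative, PowerSeries.coeff_rescale, PowerSeries.coeff_smul,
    smul_eq_mul]
  ring

theorem derivative_expNegPowDiv {m : ℕ} (hm : m ≠ 0) :
    PowerSeries.derivative ℝ (expNegPowDiv m hm) =
      -PowerSeries.X ^ (m - 1) * expNegPowDiv m hm := by
  have hcast : (m : PowerSeries ℝ) = PowerSeries.C (m : ℝ) := (map_natCast PowerSeries.C m).symm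
  rw [expNegPowDiv, PowerSeries.expand_apply,
    PowerSeries.derivative_subst (PowerSeries.HasSubst.X_pow hm), derivative_rescale,
    PowerSeries.derivative_exp, PowerSeries.derivative_pow, PowerSeries.derivative_X,
    ← PowerSeries.expand_apply m hm, ← PowerSeries.expand_apply m hm, PowerSeries.expand_smul,
    PowerSeries.smul_eq_C_mul, hcast]
  have hcancel : PowerSeries.C (-(m : ℝ)⁻¹) * PowerSeries.C (m : ℝ) = -1 := by
    rw [← map_mul, neg_mul, inv_mul_cancel₀ (by positivity), map_neg, map_one]
  linear_combination PowerSeries.expand m hm (PowerSeries.rescale (-(m : ℝ)⁻¹) (PowerSeries.exp ℝ))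
    * PowerSeries.X ^ (m - 1) * hcancel

theorem coeff_expNegPowDiv_mul {m : ℕ} (hm : m ≠ 0) (n : ℕ) :
    PowerSeries.coeff (m * n) (expNegPowDiv m hm) = (-(m : ℝ)⁻¹) ^ n / n ! := by
  simp [expNegPowDiv, PowerSeries.coeff_expand_mul, div_eq_mul_inv]

theorem coeff_expNegPowDiv_eq_zero {m : ℕ} (hm : m ≠ 0) {n : ℕ} (hn : n ∉ Set.range (m * ·)) :
    PowerSeries.coeff n (expNegPowDiv m hm) = 0 :=
  PowerSeries.coeff_expand_of_not_dvd _ _ _ fun ⟨k, hk⟩ => hn ⟨k, hk.symm⟩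

theorem hasSum_coeff_expNegPowDiv {m : ℕ} (hm : m ≠ 0) :
    HasSum (fun n => PowerSeries.coeff n (expNegPowDiv m hm)) (Real.exp (-(m : ℝ)⁻¹)) := by
  refine ((mul_right_injective₀ hm).hasSum_iff fun n => coeff_expNegPowDiv_eq_zero hm).1 ?_
  simp only [Function.comp_def, coeff_expNegPowDiv_mul, Real.exp_eq_exp_ℝ]
  exact NormedSpace.expSeries_div_hasSum_exp _

theorem mk_longCycleProb_succ {m : ℕ} (hm : m ≠ 0) :
    PowerSeries.mk (longCycleProb (m + 1)) =
      PowerSeries.mk (longCycleProb m) * expNegPowDiv m hm := by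
  refine powerSeries_ext_of_derivative_eq_mul (derivative_mk_longCycleProb m) ?_ ?_
  · obtain ⟨k, rfl⟩ := Nat.exists_eq_add_one_of_ne_zero hm
    have hgeom : (PowerSeries.mk 1 : PowerSeries ℝ) * (1 - PowerSeries.X) = 1 :=
      PowerSeries.mk_one_mul_one_sub_eq_one ℝ
    rw [Derivation.leibniz, derivative_expNegPowDiv, derivative_mk_longCycleProb, smul_eq_mul,
      smul_eq_mul, Nat.add_sub_cancel]
    linear_combination PowerSeries.X ^ k * expNegPowDiv (k + 1) hm *
      PowerSeries.mk (longCycleProb (k + 1)) * hgeom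
  · have hconst : PowerSeries.constantCoeff (expNegPowDiv m hm) = 1 := by
      simpa using coeff_expNegPowDiv_mul hm 0
    rw [map_mul, hconst, mul_one]
    simp [← PowerSeries.coeff_zero_eq_constantCoeff_apply, longCycleProb_zero_right]

theorem tendsto_coeff_mul {f g : PowerSeries ℝ} {C l s : ℝ}
    (hC : ∀ n, |PowerSeries.coeff n f| ≤ C)
    (hf : Tendsto (fun n => PowerSeries.coeff n f) atTop (𝓝 l))
    (hg : HasSum (fun n => PowerSeries.coeff n g) s) :
    Tendsto (fun n => PowerSeries.coeff n (f * g)) atTop (𝓝 (l * s)) := by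
  have hdom := tendsto_tsum_of_dominated_convergence
    (f := fun n k => if k ≤ n then PowerSeries.coeff (n - k) f * PowerSeries.coeff k g else 0)
    (g := fun k => l * PowerSeries.coeff k g) (𝓕 := atTop)
    (hg.summable.norm.mul_left C) ?_ ?_
  · rw [(hg.mul_left l).tsum_eq] at hdom
    refine hdom.congr fun n => ?_
    rw [mul_comm, PowerSeries.coeff_mul, Finset.Nat.sum_antidiagonal_eq_sum_range_succ_mk,
      tsum_eq_sum (s := Finset.range (n + 1)) fun k hk => if_neg (by simpa using hk)]
    refine Finset.sum_congr rfl fun k hk => ?_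
    rw [if_pos (Finset.mem_range_succ_iff.1 hk), mul_comm]
  · intro k
    refine ((hf.comp (tendsto_sub_atTop_nat k)).mul_const _).congr' ?_
    filter_upwards [eventually_ge_atTop k] with n hn
    rw [if_pos hn, Function.comp_apply]
  · refine Eventually.of_forall fun n k => ?_
    have hC0 : 0 ≤ C := (abs_nonneg _).trans (hC 0)
    split_ifs
    · rw [norm_mul, Real.norm_eq_abs]
      gcongr
      exact hC _
    · rw [norm_zero]
      positivity

theorem tendsto_longCycleProb (m : ℕ) :
    Tendsto (longCycleProb (m + 1)) atTop (𝓝 (Real.exp (-(harmonic m : ℝ)))) := by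
  induction m with
  | zero => simp [funext longCycleProb_one_left]
  | succ m ih =>
    have hmul := tendsto_coeff_mul (f := PowerSeries.mk (longCycleProb (m + 1))) (C := 1)
      (fun n => ?_) (by simpa using ih) (hasSum_coeff_expNegPowDiv m.succ_ne_zero)
    · rw [← mk_longCycleProb_succ, ← Real.exp_add, ← neg_add] at hmul
      simpa [harmonic_succ] using hmul
    · rw [PowerSeries.coeff_mk, abs_of_nonneg (longCycleProb_nonneg _ _)]
      exact longCycleProb_le_one _ _

theorem dist_le_of_tendsto_of_dist_succ_le {α : Type*} [PseudoMetricSpace α] {f : ℕ → α} {l : α}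
    {g : ℕ → ℝ} {n : ℕ} (hf : Tendsto f atTop (𝓝 l)) (hg : ∀ k, n ≤ k → 0 ≤ g k)
    (hfg : ∀ k, n ≤ k → dist (f k) (f (k + 1)) ≤ g k - g (k + 1)) : dist (f n) l ≤ g n := by
  refine le_of_tendsto (tendsto_const_nhds.dist hf) ?_
  filter_upwards [eventually_ge_atTop n] with N hN
  have hsum := dist_le_Ico_sum_of_dist_le hN fun {k} hk _ => hfg k hk
  simp only [Finset.sum_Ico_eq_sum_range, add_assoc] at hsum
  rw [Finset.sum_range_sub' (fun i => g (n + i)), add_zero,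
    Nat.add_sub_cancel' hN] at hsum
  linarith [hg N hN]

theorem dist_longCycleProb_exp_le {m n : ℕ} (hmn : m + 1 ≤ n) :
    dist (longCycleProb (m + 1) n) (Real.exp (-(harmonic m : ℝ))) ≤ 2 / n := by
  refine dist_le_of_tendsto_of_dist_succ_le (g := fun n => 2 / n) (tendsto_longCycleProb m)
    (fun k _ => by positivity) fun k hk => ?_
  refine (dist_longCycleProb_succ_le_sq m.succ_pos (hmn.trans hk)).trans ?_
  have hk0 : (0 : ℝ) < k := Nat.cast_pos.2 (by omega)
  rw [Nat.cast_add_one, div_sub_div _ _ hk0.ne' (by positivity),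
    div_le_div_iff₀ (by positivity) (by positivity)]
  nlinarith

/-! ### The mean -/

theorem tendsto_sum_mul_div_sum {u w : ℕ → ℝ} {c : ℝ} (hw : ∀ n, 0 ≤ w n)
    (hW : Tendsto (fun n => ∑ k ∈ Finset.range n, w k) atTop atTop)
    (hu : Tendsto u atTop (𝓝 c)) :
    Tendsto (fun n => (∑ k ∈ Finset.range n, u k * w k) / ∑ k ∈ Finset.range n, w k) atTop
      (𝓝 c) := by
  have hlittle : (fun k => (u k - c) * w k) =o[atTop] w := by
    simpa using ((Asymptotics.isLittleO_one_iff ℝ).2 (tendsto_sub_nhds_zero_iff.2 hu)).mul_isBigO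
      (Asymptotics.isBigO_refl w atTop)
  have hlim := ((hlittle.sum_range hw hW).tendsto_div_nhds_zero).add_const c
  rw [zero_add] at hlim
  refine hlim.congr' ?_
  filter_upwards [hW.eventually_gt_atTop 0] with n hn
  simp only [sub_mul]
  rw [Finset.sum_sub_distrib, ← Finset.mul_sum, sub_div, mul_div_cancel_right₀ _ hn.ne',
    sub_add_cancel]

theorem tendsto_log_natCast_atTop : Tendsto (fun n : ℕ => Real.log n) atTop atTop :=
  Real.tendsto_log_atTop.comp tendsto_natCast_atTop_atTop

theorem tendsto_harmonic_atTop : Tendsto (fun n => (harmonic n : ℝ)) atTop atTop := by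
  refine tendsto_atTop_mono (fun n => log_add_one_le_harmonic n) ?_
  exact_mod_cast tendsto_log_natCast_atTop.comp (tendsto_add_atTop_nat 1)

theorem tendsto_harmonic_div_log :
    Tendsto (fun n : ℕ => (harmonic n : ℝ) / Real.log n) atTop (𝓝 1) := by
  have hlim := (Real.tendsto_harmonic_sub_log.div_atTop tendsto_log_natCast_atTop).add_const 1
  rw [zero_add] at hlim
  refine hlim.congr' ?_
  filter_upwards [tendsto_log_natCast_atTop.eventually_gt_atTop 0] with n hn
  rw [sub_div, div_self hn.ne', sub_add_cancel]

theorem exp_neg_harmonic (k : ℕ) :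
    Real.exp (-(harmonic k : ℝ)) = Real.exp (-Real.eulerMascheroniSeq k) * ((k : ℝ) + 1)⁻¹ := by
  rw [Real.eulerMascheroniSeq, neg_sub, Real.exp_sub, Real.exp_log (by positivity), Real.exp_neg]
  field_simp

theorem tendsto_sum_exp_neg_harmonic_div_log :
    Tendsto (fun n : ℕ => (∑ k ∈ Finset.range n, Real.exp (-(harmonic k : ℝ))) / Real.log n) atTop
      (𝓝 (Real.exp (-Real.eulerMascheroniConstant))) := by
  have hharmonic (n : ℕ) : ∑ k ∈ Finset.range n, ((k : ℝ) + 1)⁻¹ = (harmonic n : ℝ) := by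
    simp [harmonic]
  have hcesaro := tendsto_sum_mul_div_sum (w := fun k : ℕ => ((k : ℝ) + 1)⁻¹)
    (fun k => by positivity) (by simpa only [hharmonic] using tendsto_harmonic_atTop)
    ((Real.continuous_exp.tendsto _).comp Real.tendsto_eulerMascheroniSeq.neg)
  simp only [Function.comp_apply, ← exp_neg_harmonic, hharmonic] at hcesaro
  have hmul := hcesaro.mul tendsto_harmonic_div_log
  rw [mul_one] at hmul
  refine hmul.congr' ?_
  filter_upwards [tendsto_harmonic_atTop.eventually_gt_atTop 0] with n hn
  rw [div_mul_div_cancel₀ hn.ne']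

theorem dist_sum_longCycleProb_sum_exp_le (n : ℕ) :
    dist (∑ k ∈ Finset.range n, longCycleProb (k + 1) n)
      (∑ k ∈ Finset.range n, Real.exp (-(harmonic k : ℝ))) ≤ 2 :=
  calc _ ≤ ∑ _k ∈ Finset.range n, 2 / (n : ℝ) := dist_sum_sum_le_of_le _ fun _ hk =>
        dist_longCycleProb_exp_le (Finset.mem_range.1 hk)
    _ = n * (2 / n) := by rw [Finset.sum_const, Finset.card_range, nsmul_eq_mul]
    _ ≤ 2 := by rcases eq_or_ne (n : ℝ) 0 with hn | hn <;> simp [hn, mul_div_cancel₀]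

theorem tendsto_sum_longCycleProb_div_log :
    Tendsto (fun n : ℕ => (∑ k ∈ Finset.range n, longCycleProb (k + 1) n) / Real.log n) atTop
      (𝓝 (Real.exp (-Real.eulerMascheroniConstant))) := by
  refine tendsto_sum_exp_neg_harmonic_div_log.congr_dist ?_
  refine squeeze_zero' (Eventually.of_forall fun _ => dist_nonneg) ?_
    (tendsto_log_natCast_atTop.const_div_atTop 2)
  filter_upwards [tendsto_log_natCast_atTop.eventually_gt_atTop 0] with n hn
  rw [Real.dist_eq, ← sub_div, abs_div, abs_of_pos hn, ← Real.dist_eq, dist_comm]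
  gcongr
  exact dist_sum_longCycleProb_sum_exp_le n

/-! ### The Buchstab function -/

/-- Picard iterates for `max 1 u * ω u = 1 + ∫ t in 1..max 1 (u - 1), ω t`, the integral equation
of the Buchstab function `ω`. -/
noncomputable def buchstabIter : ℕ → ℝ → ℝ
  | 0, u => (max 1 u)⁻¹
  | k + 1, u => (1 + ∫ t in (1 : ℝ)..max 1 (u - 1), buchstabIter k t) / max 1 u

theorem buchstabIter_succ (k : ℕ) (u : ℝ) :
    buchstabIter (k + 1) u =
      (1 + ∫ t in (1 : ℝ)..max 1 (u - 1), buchstabIter k t) / max 1 u :=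
  rfl

theorem max_one_pos (u : ℝ) : 0 < max 1 u := lt_max_of_lt_left one_pos

theorem continuous_buchstabIter (k : ℕ) : Continuous (buchstabIter k) := by
  have hmax : Continuous fun u : ℝ => max 1 u := by fun_prop
  induction k with
  | zero => exact hmax.inv₀ fun u => (max_one_pos u).ne'
  | succ k ih =>
    have hprim := (intervalIntegral.continuous_primitive
      (fun a b => ih.intervalIntegrable (μ := volume) a b) 1).comp
      (hmax.comp (continuous_sub_right 1))
    exact (continuous_const.add hprim).div hmax fun u => (max_one_pos u).ne'

theorem buchstabIter_mem_Icc (k : ℕ) (u : ℝ) : buchstabIter k u ∈ Set.Icc (0 : ℝ) 1 := by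
  induction k generalizing u with
  | zero => exact ⟨inv_nonneg.2 (max_one_pos u).le, inv_le_one_of_one_le₀ (le_max_left 1 u)⟩
  | succ k ih =>
    have hint_nonneg : 0 ≤ ∫ t in (1 : ℝ)..max 1 (u - 1), buchstabIter k t :=
      intervalIntegral.integral_nonneg (le_max_left _ _) fun t _ => (ih t).1
    have hint_le : ∫ t in (1 : ℝ)..max 1 (u - 1), buchstabIter k t ≤ max 1 (u - 1) - 1 := by
      have hmono := intervalIntegral.integral_mono (μ := volume) (le_max_left 1 (u - 1))
        ((continuous_buchstabIter k).intervalIntegrable _ _)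
        (continuous_const.intervalIntegrable _ _) fun t => (ih t).2
      rwa [intervalIntegral.integral_const, smul_eq_mul, mul_one] at hmono
    have hmax : max 1 (u - 1) ≤ max 1 u := max_le_max le_rfl (sub_le_self u zero_le_one)
    exact ⟨div_nonneg (by linarith) (max_one_pos u).le,
      (div_le_one (max_one_pos u)).2 (by linarith)⟩

theorem buchstabIter_succ_eq {k : ℕ} {u : ℝ} (hu : u ≤ k + 2) :
    buchstabIter (k + 1) u = buchstabIter k u := by
  induction k generalizing u with
  | zero =>
    rw [Nat.cast_zero] at hu
    rw [buchstabIter_succ, max_eq_left (by linarith : u - 1 ≤ 1), intervalIntegral.integral_same,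
      add_zero, one_div, buchstabIter]
  | succ k ih =>
    rw [Nat.cast_succ] at hu
    rw [buchstabIter_succ, buchstabIter_succ k]
    congr 2
    refine intervalIntegral.integral_congr fun t ht => ih ?_
    rw [Set.uIcc_of_le (le_max_left _ _)] at ht
    exact ht.2.trans (max_le (by linarith [k.cast_nonneg (α := ℝ)]) (by linarith))

theorem buchstabIter_eq_of_le {k j : ℕ} (hkj : k ≤ j) {u : ℝ} (hu : u ≤ k + 2) :
    buchstabIter j u = buchstabIter k u := by
  induction j, hkj using Nat.le_induction with
  | base => rfl
  | succ j hj ih =>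
    have hkj : (k : ℝ) ≤ j := Nat.cast_le.2 hj
    rw [buchstabIter_succ_eq (hu.trans (by linarith)), ih]

/-- The Buchstab function `ω`: `u ω(u) = 1` for `1 ≤ u ≤ 2` and `(u ω(u))' = ω(u - 1)` for `2 < u`,
extended by `ω(u) = 1` to `u ≤ 1`. It describes the limit shape of `longCycleProb`. -/
noncomputable def buchstab (u : ℝ) : ℝ := buchstabIter ⌈u⌉₊ u

theorem buchstab_eq_buchstabIter {k : ℕ} {u : ℝ} (hu : u ≤ k + 2) :
    buchstab u = buchstabIter k u := by
  have hceil := Nat.le_ceil u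
  rcases le_total k ⌈u⌉₊ with h | h
  · exact buchstabIter_eq_of_le h hu
  · exact (buchstabIter_eq_of_le h (by linarith)).symm

theorem buchstab_nonneg (u : ℝ) : 0 ≤ buchstab u := (buchstabIter_mem_Icc _ _).1

theorem buchstab_le_one (u : ℝ) : buchstab u ≤ 1 := (buchstabIter_mem_Icc _ _).2

theorem norm_buchstab_le_one (u : ℝ) : ‖buchstab u‖ ≤ 1 :=
  (Real.norm_of_nonneg (buchstab_nonneg u)).trans_le (buchstab_le_one u)

theorem continuous_buchstab : Continuous buchstab := by
  refine continuous_iff_continuousAt.2 fun u => ?_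
  refine (continuous_buchstabIter ⌈u⌉₊).continuousAt.congr ?_
  filter_upwards [Iio_mem_nhds (by linarith [Nat.le_ceil u] : u < ⌈u⌉₊ + 2)] with w hw
  exact (buchstab_eq_buchstabIter (le_of_lt hw)).symm

theorem max_one_mul_buchstab (u : ℝ) :
    max 1 u * buchstab u = 1 + ∫ t in (1 : ℝ)..max 1 (u - 1), buchstab t := by
  have hceil := Nat.le_ceil u
  rw [buchstab_eq_buchstabIter (k := ⌈u⌉₊ + 1) (by push_cast; linarith), buchstabIter_succ,
    mul_div_cancel₀ _ (max_one_pos u).ne']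
  congr 1
  refine intervalIntegral.integral_congr fun t ht => (buchstab_eq_buchstabIter ?_).symm
  rw [Set.uIcc_of_le (le_max_left _ _)] at ht
  exact ht.2.trans (max_le (by linarith [⌈u⌉₊.cast_nonneg (α := ℝ)]) (by linarith))

theorem mul_buchstab_of_le_two {u : ℝ} (hu₁ : 1 ≤ u) (hu₂ : u ≤ 2) : u * buchstab u = 1 := by
  have h := max_one_mul_buchstab u
  rwa [max_eq_right hu₁, max_eq_left (by linarith), intervalIntegral.integral_same,
    add_zero] at h

theorem mul_buchstab_of_two_le {u : ℝ} (hu : 2 ≤ u) :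
    u * buchstab u = 1 + ∫ t in (1 : ℝ)..(u - 1), buchstab t := by
  have h := max_one_mul_buchstab u
  rwa [max_eq_right (by linarith), max_eq_right (by linarith)] at h

theorem hasDerivAt_mul_buchstab {u : ℝ} (hu : 2 < u) :
    HasDerivAt (fun w => w * buchstab w) (buchstab (u - 1)) u := by
  have hprim : HasDerivAt (fun w => ∫ t in (1 : ℝ)..w, buchstab t) (buchstab (u - 1)) (u - 1) :=
    intervalIntegral.integral_hasDerivAt_right (continuous_buchstab.intervalIntegrable _ _)
      (continuous_buchstab.stronglyMeasurableAtFilter _ _) continuous_buchstab.continuousAt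
  refine ((hprim.comp_sub_const u 1).const_add 1).congr_of_eventuallyEq ?_
  filter_upwards [Ioi_mem_nhds hu] with w hw
  exact mul_buchstab_of_two_le (le_of_lt hw)

theorem dist_max_one_le (u w : ℝ) : dist (max 1 u) (max 1 w) ≤ dist u w := by
  rw [max_comm 1 u, max_comm 1 w]
  exact abs_max_sub_max_le_abs u w 1

theorem dist_max_one_mul_buchstab_le (u w : ℝ) :
    dist (max 1 u * buchstab u) (max 1 w * buchstab w) ≤ dist u w := by
  rw [max_one_mul_buchstab u, max_one_mul_buchstab w, dist_add_left, Real.dist_eq,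
    intervalIntegral.integral_interval_sub_left (continuous_buchstab.intervalIntegrable _ _)
      (continuous_buchstab.intervalIntegrable _ _)]
  calc _ ≤ 1 * |max 1 (u - 1) - max 1 (w - 1)| :=
        intervalIntegral.norm_integral_le_of_norm_le_const fun t _ => norm_buchstab_le_one t
    _ ≤ dist (u - 1) (w - 1) := (one_mul _).trans_le (dist_max_one_le _ _)
    _ = dist u w := dist_sub_right u w 1

theorem lipschitzWith_buchstab : LipschitzWith 2 buchstab := by
  refine LipschitzWith.of_dist_le_mul fun u w => ?_
  have hsplit : max 1 u * (buchstab u - buchstab w) =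
      (max 1 u * buchstab u - max 1 w * buchstab w) + (max 1 w - max 1 u) * buchstab w := by
    ring
  calc dist (buchstab u) (buchstab w) ≤ max 1 u * |buchstab u - buchstab w| :=
        le_mul_of_one_le_left dist_nonneg (le_max_left 1 u)
    _ = |max 1 u * (buchstab u - buchstab w)| := by rw [abs_mul, abs_of_pos (max_one_pos u)]
    _ ≤ dist (max 1 u * buchstab u) (max 1 w * buchstab w) +
          dist (max 1 w) (max 1 u) * ‖buchstab w‖ := by
        rw [hsplit, Real.dist_eq, Real.dist_eq, ← Real.norm_eq_abs (max 1 w - _), ← norm_mul]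
        exact abs_add_le _ _
    _ ≤ dist u w + dist u w * 1 := by
        rw [dist_comm (max 1 w)]
        gcongr
        exacts [dist_max_one_mul_buchstab_le u w, dist_max_one_le u w, norm_buchstab_le_one w]
    _ = (2 : NNReal) * dist u w := by push_cast; ring

theorem dist_sub_mul_integral_le_of_lipschitzWith {K : NNReal} {f : ℝ → ℝ}
    (hf : LipschitzWith K f) {a b : ℝ} (hab : a ≤ b) :
    dist ((b - a) * f a) (∫ t in a..b, f t) ≤ K * (b - a) ^ 2 := by
  rw [← smul_eq_mul, ← intervalIntegral.integral_const, dist_comm, dist_eq_norm,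
    ← intervalIntegral.integral_sub (hf.continuous.intervalIntegrable _ _)
      (continuous_const.intervalIntegrable _ _)]
  calc _ ≤ K * (b - a) * |b - a| :=
        intervalIntegral.norm_integral_le_of_norm_le_const fun t ht => by
          rw [Set.uIoc_of_le hab] at ht
          rw [← dist_eq_norm]
          refine (hf.dist_le_mul t a).trans ?_
          rw [Real.dist_eq, abs_of_pos (sub_pos.2 ht.1)]
          gcongr
          exact ht.2
    _ = K * (b - a) ^ 2 := by rw [abs_of_nonneg (sub_nonneg.2 hab)]; ring

theorem mul_longCycleProb_eq_one_add {m n : ℕ} (hm : 0 < m) (hmn : m ≤ n) :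
    n * longCycleProb m n = 1 + ∑ j ∈ Finset.Ico m (n + 1 - m), longCycleProb m j := by
  rw [mul_longCycleProb hm, Finset.range_eq_Ico, Finset.sum_eq_sum_Ico_succ_bot (by omega),
    longCycleProb_zero_right]
  congr 1
  refine (Finset.sum_subset (Finset.Ico_subset_Ico_left hm) fun j hj hj' => ?_).symm
  rw [Finset.mem_Ico] at hj hj'
  exact longCycleProb_of_lt (by omega) (by omega)

theorem integral_buchstab_eq_sum {m n : ℕ} (hm : 0 < m) (hmn : 2 * m ≤ n) :
    ∫ t in (1 : ℝ)..(n / m - 1), buchstab t =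
      ∑ j ∈ Finset.Ico m (n - m), ∫ t in (j / m : ℝ)..((j + 1 : ℕ) / m : ℝ), buchstab t := by
  have hm' : (m : ℝ) ≠ 0 := Nat.cast_ne_zero.2 hm.ne'
  rw [intervalIntegral.sum_integral_adjacent_intervals_Ico (a := fun j : ℕ => (j / m : ℝ))
    (by omega) fun j _ => continuous_buchstab.intervalIntegrable _ _, div_self hm',
    Nat.cast_sub (by omega), sub_div, div_self hm']

theorem dist_longCycleProb_integral_buchstab_le {m : ℕ} (hm : 0 < m) (j : ℕ) :
    dist (longCycleProb m j) (∫ t in (j / m : ℝ)..((j + 1 : ℕ) / m : ℝ), buchstab t) ≤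
      dist (m * longCycleProb m j) (buchstab (j / m)) / m + 2 / (m : ℝ) ^ 2 := by
  have hm' : (0 : ℝ) < m := Nat.cast_pos.2 hm
  have hlength : ((j + 1 : ℕ) / m : ℝ) - j / m = 1 / m := by push_cast; ring
  have hriemann := dist_sub_mul_integral_le_of_lipschitzWith lipschitzWith_buchstab
    (by gcongr; omega : (j / m : ℝ) ≤ ((j + 1 : ℕ) / m : ℝ))
  rw [hlength] at hriemann
  have hscale : dist (longCycleProb m j) (1 / m * buchstab (j / m)) =
      dist (m * longCycleProb m j) (buchstab (j / m)) / m := by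
    rw [Real.dist_eq, Real.dist_eq, ← abs_of_pos hm', ← abs_div, abs_of_pos hm', sub_div,
      mul_div_cancel_left₀ _ hm'.ne', one_div_mul_eq_div]
  calc _ ≤ dist (longCycleProb m j) (1 / m * buchstab (j / m)) + _ := dist_triangle _ _ _
    _ ≤ _ := by
      rw [hscale]
      gcongr
      exact hriemann.trans_eq (by push_cast; ring)

theorem mul_longCycleProb_eq_buchstab {m n : ℕ} (hm : 0 < m) (hmn : m ≤ n) (hnm : n < 2 * m) :
    m * longCycleProb m n = buchstab (n / m) := by
  have hm' : (0 : ℝ) < m := Nat.cast_pos.2 hm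
  have hn' : (0 : ℝ) < n := Nat.cast_pos.2 (hm.trans_le hmn)
  have hprob := mul_longCycleProb_eq_one_add hm hmn
  rw [Finset.Ico_eq_empty (by omega), Finset.sum_empty, add_zero] at hprob
  have hbuchstab := mul_buchstab_of_le_two ((one_le_div hm').2 (Nat.cast_le.2 hmn))
    ((div_le_iff₀ hm').2 (by exact_mod_cast hnm.le))
  rw [eq_div_of_mul_eq hn'.ne' ((mul_comm _ _).trans hprob),
    eq_div_of_mul_eq (div_pos hn' hm').ne' ((mul_comm _ _).trans hbuchstab), one_div_div,
    mul_one_div]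

theorem div_mul_dist_mul_longCycleProb_buchstab_le {m n : ℕ} (hm : 0 < m) (hmn : 2 * m ≤ n) :
    n / m * dist (m * longCycleProb m n) (buchstab (n / m)) ≤
      ∑ j ∈ Finset.Ico m (n - m),
        (dist (m * longCycleProb m j) (buchstab (j / m)) / m + 2 / (m : ℝ) ^ 2) + (m : ℝ)⁻¹ := by
  have hm' : (0 : ℝ) < m := Nat.cast_pos.2 hm
  have htwo : (2 : ℝ) ≤ n / m := (le_div_iff₀ hm').2 (by exact_mod_cast hmn)
  have hscale : n / m * dist (m * longCycleProb m n) (buchstab (n / m)) =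
      dist (n * longCycleProb m n) (n / m * buchstab (n / m)) := by
    rw [← Real.norm_of_nonneg (zero_le_two.trans htwo), ← dist_smul₀, smul_eq_mul, smul_eq_mul,
      ← mul_assoc, Real.norm_of_nonneg (zero_le_two.trans htwo), div_mul_cancel₀ _ hm'.ne']
  rw [hscale, mul_longCycleProb_eq_one_add hm (by omega), mul_buchstab_of_two_le htwo,
    dist_add_left, integral_buchstab_eq_sum hm hmn, Nat.sub_add_comm (by omega),
    Finset.sum_Ico_succ_top (by omega)]
  refine (dist_triangle_left _ _ (∑ j ∈ Finset.Ico m (n - m), longCycleProb m j)).trans ?_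
  rw [add_comm, dist_self_add_right, Real.norm_of_nonneg (longCycleProb_nonneg _ _)]
  exact add_le_add
    (dist_sum_sum_le_of_le _ fun j _ => dist_longCycleProb_integral_buchstab_le hm j)
    (longCycleProb_le_inv hm (by omega))

theorem sum_Ico_natCast_le (a n : ℕ) : ∑ j ∈ Finset.Ico a n, (j : ℝ) ≤ (n : ℝ) ^ 2 / 2 := by
  have hgauss : ∑ j ∈ Finset.range n, (j : ℝ) = n * (n - 1) / 2 := by
    induction n with
    | zero => simp
    | succ n ih => rw [Finset.sum_range_succ, ih]; push_cast; ring
  calc ∑ j ∈ Finset.Ico a n, (j : ℝ) ≤ ∑ j ∈ Finset.range n, (j : ℝ) := by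
        rw [Finset.range_eq_Ico]
        exact Finset.sum_le_sum_of_subset_of_nonneg (Finset.Ico_subset_Ico_left a.zero_le)
          fun j _ _ => j.cast_nonneg
    _ ≤ (n : ℝ) ^ 2 / 2 := by rw [hgauss]; nlinarith [n.cast_nonneg (α := ℝ)]

/- The recurrence for `longCycleProb m` is a Riemann sum with mesh `1 / m` for the integral equation
of the Buchstab function. -/
theorem dist_mul_longCycleProb_buchstab_le {m n : ℕ} (hm : 0 < m) (hmn : m ≤ n) :
    dist (m * longCycleProb m n) (buchstab (n / m)) ≤ n / (m : ℝ) ^ 2 := by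
  have hm' : (0 : ℝ) < m := Nat.cast_pos.2 hm
  induction n using Nat.strong_induction_on with
  | _ n ih =>
  rcases lt_or_ge n (2 * m) with hnm | hnm
  · rw [mul_longCycleProb_eq_buchstab hm hmn hnm, dist_self]
    positivity
  have hcard : ((n - m - m : ℕ) : ℝ) = n - 2 * m := by
    rw [Nat.cast_sub (by omega), Nat.cast_sub hmn]; ring
  have hsum_id : ∑ j ∈ Finset.Ico m (n - m), (j : ℝ) ≤ (n : ℝ) ^ 2 / 2 :=
    (sum_Ico_natCast_le m (n - m)).trans (by gcongr; omega)
  refine le_of_mul_le_mul_left ?_ (div_pos (Nat.cast_pos.2 (by omega)) hm' : (0 : ℝ) < n / m)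
  calc n / m * dist (m * longCycleProb m n) (buchstab (n / m))
      ≤ ∑ j ∈ Finset.Ico m (n - m), (j / (m : ℝ) ^ 2 / m + 2 / (m : ℝ) ^ 2) + (m : ℝ)⁻¹ := by
        refine (div_mul_dist_mul_longCycleProb_buchstab_le hm hnm).trans ?_
        gcongr with j hj
        rw [Finset.mem_Ico] at hj
        exact ih j (by omega) hj.1
    _ ≤ (n : ℝ) ^ 2 / 2 / m ^ 2 / m + (n - 2 * m) * (2 / m ^ 2) + (m : ℝ)⁻¹ := by
        rw [Finset.sum_add_distrib, ← Finset.sum_div, ← Finset.sum_div, Finset.sum_const,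
          nsmul_eq_mul, Nat.card_Ico, hcard]
        gcongr
    _ = n / m * (n / m ^ 2) - (((n : ℝ) - 2 * m) ^ 2 + 2 * m ^ 2) / (2 * m ^ 3) := by
        field_simp
        ring
    _ ≤ n / m * (n / m ^ 2) := sub_le_self _ (by positivity)

/-! ### The Laplace transform of the Buchstab function -/

section LaplaceTransform

theorem integrableOn_pow_mul_exp_neg_mul (k : ℕ) {s : ℝ} (hs : 0 < s) :
    IntegrableOn (fun u : ℝ => u ^ k * Real.exp (-s * u)) (Set.Ioi 0) := by
  have hk : (-1 : ℝ) < k := neg_one_lt_zero.trans_le k.cast_nonneg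
  simpa only [Real.rpow_one, Real.rpow_natCast] using
    integrableOn_rpow_mul_exp_neg_mul_rpow hk one_pos hs

theorem integral_pow_mul_exp_neg_mul (k : ℕ) {s : ℝ} (hs : 0 < s) :
    ∫ u in Set.Ioi (0 : ℝ), u ^ k * Real.exp (-s * u) = k ! / s ^ (k + 1) := by
  have hgamma := Real.integral_rpow_mul_exp_neg_mul_Ioi (a := k + 1) (by positivity) hs
  rw [add_sub_cancel_right, Real.Gamma_nat_eq_factorial, ← Nat.cast_succ, Real.rpow_natCast,
    one_div, inv_pow, inv_mul_eq_div] at hgamma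
  simpa only [Real.rpow_natCast, ← neg_mul] using hgamma

variable {f : ℝ → ℝ} {a s C : ℝ}

theorem integrableOn_bdd_mul_pow_mul_exp_neg_mul
    (hf : AEStronglyMeasurable f (volume.restrict (Set.Ioi a))) (hfC : ∀ u, ‖f u‖ ≤ C)
    (ha : 0 ≤ a) (k : ℕ) (hs : 0 < s) :
    IntegrableOn (fun u => f u * (u ^ k * Real.exp (-s * u))) (Set.Ioi a) :=
  Integrable.bdd_mul
    ((integrableOn_pow_mul_exp_neg_mul k hs).mono_set (Set.Ioi_subset_Ioi ha)) hf
    (ae_of_all _ hfC)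

theorem integrableOn_bdd_mul_exp_neg_mul
    (hf : AEStronglyMeasurable f (volume.restrict (Set.Ioi a))) (hfC : ∀ u, ‖f u‖ ≤ C)
    (hs : 0 < s) : IntegrableOn (fun u => f u * Real.exp (-s * u)) (Set.Ioi a) :=
  Integrable.bdd_mul (integrableOn_exp_mul_Ioi (neg_lt_zero.2 hs) a) hf (ae_of_all _ hfC)

theorem hasDerivAt_integral_mul_exp_neg_mul
    (hf : AEStronglyMeasurable f (volume.restrict (Set.Ioi a))) (hfC : ∀ u, ‖f u‖ ≤ C)
    (ha : 0 ≤ a) (hs : 0 < s) :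
    HasDerivAt (fun s => ∫ u in Set.Ioi a, f u * Real.exp (-s * u))
      (-∫ u in Set.Ioi a, u * f u * Real.exp (-s * u)) s := by
  rw [← integral_neg]
  have hexp (r : ℝ) : Continuous fun u => Real.exp (-r * u) := by fun_prop
  refine (hasDerivAt_integral_of_dominated_loc_of_deriv_le
    (F := fun r u => f u * Real.exp (-r * u)) (F' := fun r u => -(u * f u * Real.exp (-r * u)))
    (bound := fun u => C * (u ^ 1 * Real.exp (-(s / 2) * u)))
    (Ioi_mem_nhds (half_lt_self hs)) (Eventually.of_forall fun r => ?_)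
    (integrableOn_bdd_mul_exp_neg_mul hf hfC hs) ?_ ?_ ?_ ?_).2
  · exact hf.mul (hexp r).aestronglyMeasurable
  · exact ((continuous_id.aestronglyMeasurable.mul hf).mul (hexp s).aestronglyMeasurable).neg
  · filter_upwards [ae_restrict_mem measurableSet_Ioi] with u hu r hr
    have hu_pos : 0 < u := ha.trans_lt hu
    rw [norm_neg, norm_mul, norm_mul, Real.norm_of_nonneg hu_pos.le,
      Real.norm_of_nonneg (Real.exp_pos _).le, pow_one, mul_comm u, mul_assoc]
    have hr' : s / 2 ≤ r := le_of_lt hr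
    gcongr
    exacts [(norm_nonneg _).trans (hfC u), hfC u]
  · exact ((integrableOn_pow_mul_exp_neg_mul 1 (half_pos hs)).mono_set
      (Set.Ioi_subset_Ioi ha)).const_mul C
  · refine ae_of_all _ fun u r _ => ?_
    refine (((hasDerivAt_neg r).mul_const u).exp.const_mul (f u)).congr_deriv ?_
    ring

theorem integral_mul_exp_neg_mul_eq_of_hasDerivAt {f' : ℝ → ℝ} (hs : s ≠ 0)
    (hcont : ContinuousWithinAt f (Set.Ici a) a)
    (hderiv : ∀ u ∈ Set.Ioi a, HasDerivAt f (f' u) u)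
    (hint : IntegrableOn (fun u => f u * Real.exp (-s * u)) (Set.Ioi a))
    (hint' : IntegrableOn (fun u => f' u * Real.exp (-s * u)) (Set.Ioi a)) :
    ∫ u in Set.Ioi a, f u * Real.exp (-s * u) =
      (f a * Real.exp (-s * a) + ∫ u in Set.Ioi a, f' u * Real.exp (-s * u)) / s := by
  have hderiv_mul : ∀ u ∈ Set.Ioi a, HasDerivAt (fun u => f u * Real.exp (-s * u))
      (f' u * Real.exp (-s * u) - s * (f u * Real.exp (-s * u))) u := fun u hu =>
    ((hderiv u hu).mul ((hasDerivAt_id u).const_mul (-s)).exp).congr_deriv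
      (by simp only [id]; ring)
  have hcont_mul : ContinuousWithinAt (fun u => f u * Real.exp (-s * u)) (Set.Ici a) a :=
    hcont.mul (by fun_prop)
  have hint_deriv := hint'.sub (hint.const_mul s)
  have hftc := integral_Ioi_of_hasDerivAt_of_tendsto hcont_mul hderiv_mul hint_deriv
    (tendsto_zero_of_hasDerivAt_of_integrableOn_Ioi hderiv_mul hint_deriv hint)
  rw [integral_sub hint' (hint.const_mul s), integral_const_mul] at hftc
  rw [eq_div_iff hs]
  linarith

theorem setIntegral_Ioi_comp_sub_right (f : ℝ → ℝ) (a b : ℝ) :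
    ∫ u in Set.Ioi (a + b), f (u - b) = ∫ u in Set.Ioi a, f u := by
  rw [← (measurePreserving_sub_right (volume : Measure ℝ) b).setIntegral_preimage_emb
    (measurableEmbedding_subRight b) f (Set.Ioi a), Set.preimage_sub_const_Ioi]

theorem integral_exp_neg_mul_Ioi (hs : 0 < s) (a : ℝ) :
    ∫ u in Set.Ioi a, Real.exp (-s * u) = Real.exp (-s * a) / s := by
  rw [integral_exp_mul_Ioi (neg_lt_zero.2 hs), neg_div_neg_eq]

end LaplaceTransform

/-- The Laplace transform of the Buchstab function restricted to `u > 1`. -/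
noncomputable def buchstabLaplace (s : ℝ) : ℝ :=
  ∫ u in Set.Ioi (1 : ℝ), buchstab u * Real.exp (-s * u)

theorem integrableOn_buchstab_mul_exp {s : ℝ} (hs : 0 < s) (a : ℝ) :
    IntegrableOn (fun u => buchstab u * Real.exp (-s * u)) (Set.Ioi a) :=
  integrableOn_bdd_mul_exp_neg_mul continuous_buchstab.aestronglyMeasurable
    norm_buchstab_le_one hs

theorem integrableOn_mul_buchstab_mul_exp {s a : ℝ} (hs : 0 < s) (ha : 0 ≤ a) :
    IntegrableOn (fun u => u * buchstab u * Real.exp (-s * u)) (Set.Ioi a) := by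
  refine (integrableOn_bdd_mul_pow_mul_exp_neg_mul continuous_buchstab.aestronglyMeasurable
    norm_buchstab_le_one ha 1 hs).congr (ae_of_all _ fun u => ?_)
  ring

theorem buchstabLaplace_nonneg (s : ℝ) : 0 ≤ buchstabLaplace s :=
  integral_nonneg fun u => mul_nonneg (buchstab_nonneg u) (Real.exp_pos _).le

theorem buchstabLaplace_le {s : ℝ} (hs : 0 < s) : buchstabLaplace s ≤ Real.exp (-s) / s := by
  rw [← mul_one (-s), ← integral_exp_neg_mul_Ioi hs 1]
  exact integral_mono (integrableOn_buchstab_mul_exp hs 1)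
    (integrableOn_exp_mul_Ioi (neg_lt_zero.2 hs) 1) fun u =>
      mul_le_of_le_one_left (Real.exp_pos _).le (buchstab_le_one u)

theorem tendsto_buchstabLaplace : Tendsto buchstabLaplace atTop (𝓝 0) :=
  squeeze_zero' (Eventually.of_forall buchstabLaplace_nonneg)
    ((eventually_gt_atTop 0).mono fun _ => buchstabLaplace_le)
    (Real.tendsto_exp_neg_atTop_nhds_zero.div_atTop tendsto_id)

theorem setIntegral_buchstab_sub_one_mul_exp (s : ℝ) :
    ∫ u in Set.Ioi (2 : ℝ), buchstab (u - 1) * Real.exp (-s * u) =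
      Real.exp (-s) * buchstabLaplace s := by
  rw [buchstabLaplace, ← integral_const_mul, ← setIntegral_Ioi_comp_sub_right _ 1 1,
    one_add_one_eq_two]
  refine integral_congr_ae (ae_of_all _ fun u => ?_)
  dsimp only
  rw [mul_left_comm, ← Real.exp_add]
  ring_nf

theorem integral_mul_buchstab_mul_exp_one_two {s : ℝ} (hs : s ≠ 0) :
    ∫ u in (1 : ℝ)..2, u * buchstab u * Real.exp (-s * u) =
      (Real.exp (-s) - Real.exp (-s * 2)) / s := by
  have hexp : ∫ u in (1 : ℝ)..2, Real.exp (-s * u) =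
      (Real.exp (-s) - Real.exp (-s * 2)) / s := by
    rw [intervalIntegral.integral_comp_mul_left Real.exp (neg_ne_zero.2 hs), integral_exp, mul_one,
      smul_eq_mul, inv_neg, neg_mul, ← mul_neg, neg_sub, inv_mul_eq_div]
  rw [← hexp]
  refine intervalIntegral.integral_congr fun u hu => ?_
  rw [Set.uIcc_of_le one_le_two] at hu
  simp only [mul_buchstab_of_le_two hu.1 hu.2, one_mul]

theorem setIntegral_mul_buchstab_mul_exp {s : ℝ} (hs : 0 < s) :
    ∫ u in Set.Ioi (1 : ℝ), u * buchstab u * Real.exp (-s * u) =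
      Real.exp (-s) / s * (1 + buchstabLaplace s) := by
  have hcont : Continuous fun u => u * buchstab u := continuous_id.mul continuous_buchstab
  have htail := integral_mul_exp_neg_mul_eq_of_hasDerivAt hs.ne' hcont.continuousWithinAt
    (fun u hu => hasDerivAt_mul_buchstab hu)
    (integrableOn_mul_buchstab_mul_exp hs zero_le_two)
    (integrableOn_bdd_mul_exp_neg_mul
      (continuous_buchstab.comp (continuous_sub_right 1)).aestronglyMeasurable
      (fun u => norm_buchstab_le_one (u - 1)) hs)
  rw [mul_buchstab_of_le_two one_le_two le_rfl, one_mul, setIntegral_buchstab_sub_one_mul_exp]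
    at htail
  rw [← intervalIntegral.integral_interval_add_Ioi
    (integrableOn_mul_buchstab_mul_exp hs zero_le_one)
    (integrableOn_mul_buchstab_mul_exp hs zero_le_two), htail,
    integral_mul_buchstab_mul_exp_one_two hs.ne']
  ring

theorem hasDerivAt_buchstabLaplace {s : ℝ} (hs : 0 < s) :
    HasDerivAt buchstabLaplace (-(Real.exp (-s) / s * (1 + buchstabLaplace s))) s := by
  rw [← setIntegral_mul_buchstab_mul_exp hs]
  exact hasDerivAt_integral_mul_exp_neg_mul continuous_buchstab.aestronglyMeasurable
    norm_buchstab_le_one zero_le_one hs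

/- Both sides tend to `1` at infinity and have logarithmic derivative `-exp (-s) / s`. -/
theorem exp_expIntegral {s : ℝ} (hs : 0 < s) :
    Real.exp (expIntegral s) = 1 + buchstabLaplace s := by
  have hpos (r : ℝ) : 0 < 1 + buchstabLaplace r :=
    add_pos_of_pos_of_nonneg one_pos (buchstabLaplace_nonneg r)
  have hderiv : ∀ r ∈ Set.Ici s, HasDerivAt (fun r => -Real.log (1 + buchstabLaplace r))
      (Real.exp (-r) / r) r := fun r hr => by
    refine (((hasDerivAt_buchstabLaplace (hs.trans_le hr)).const_add 1).log
      (hpos r).ne').neg.congr_deriv ?_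
    rw [neg_div, neg_neg, mul_div_cancel_right₀ _ (hpos r).ne']
  have hlim : Tendsto (fun r => -Real.log (1 + buchstabLaplace r)) atTop (𝓝 0) := by
    have hlog := ((tendsto_buchstabLaplace.const_add 1).log (by norm_num)).neg
    rwa [add_zero, Real.log_one, neg_zero] at hlog
  have hnonneg : ∀ r ∈ Set.Ioi s, 0 ≤ Real.exp (-r) / r := fun r hr =>
    div_nonneg (Real.exp_pos _).le (hs.trans hr).le
  rw [expIntegral, integral_Ioi_of_hasDerivAt_of_nonneg' hderiv hnonneg hlim, zero_sub, neg_neg,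
    Real.exp_log (hpos s)]

theorem pow_mul_exp_expIntegral_sub (k : ℕ) {s : ℝ} (hs : 0 < s) :
    s ^ k * Real.exp (expIntegral s - s) =
      ∫ u in Set.Ioi (1 : ℝ), s ^ (k + 1) * (u * buchstab u * Real.exp (-s * u)) := by
  rw [integral_const_mul, setIntegral_mul_buchstab_mul_exp hs, ← exp_expIntegral hs,
    sub_eq_add_neg, Real.exp_add, pow_succ]
  field_simp

theorem integral_pow_mul_mul_exp_neg_mul (k : ℕ) (c : ℝ) {u : ℝ} (hu : 0 < u) :
    ∫ s in Set.Ioi (0 : ℝ), s ^ k * (c * Real.exp (-s * u)) = k ! * (c / u ^ (k + 1)) := by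
  rw [mul_div_left_comm, ← integral_pow_mul_exp_neg_mul k hu, ← integral_const_mul]
  refine integral_congr_ae (ae_of_all _ fun s => ?_)
  dsimp only
  rw [mul_left_comm, neg_mul_comm, mul_comm s]

theorem integrable_prod_pow_mul_mul_exp_neg_mul {f : ℝ → ℝ} {a : ℝ} (ha : 0 ≤ a) (k : ℕ)
    (hmeas : AEStronglyMeasurable f (volume.restrict (Set.Ioi a)))
    (hint : IntegrableOn (fun u => f u / u ^ (k + 1)) (Set.Ioi a)) :
    Integrable (fun p : ℝ × ℝ => p.1 ^ k * (f p.2 * Real.exp (-p.1 * p.2)))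
      ((volume.restrict (Set.Ioi 0)).prod (volume.restrict (Set.Ioi a))) := by
  have hpow : Continuous fun p : ℝ × ℝ => p.1 ^ k := by fun_prop
  have hexp : Continuous fun p : ℝ × ℝ => Real.exp (-p.1 * p.2) := by fun_prop
  have hmeas_prod : AEStronglyMeasurable
      (fun p : ℝ × ℝ => p.1 ^ k * (f p.2 * Real.exp (-p.1 * p.2)))
      ((volume.restrict (Set.Ioi 0)).prod (volume.restrict (Set.Ioi a))) :=
    hpow.aestronglyMeasurable.mul (hmeas.comp_snd.mul hexp.aestronglyMeasurable)
  refine (integrable_prod_iff' hmeas_prod).2 ⟨?_, ?_⟩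
  · filter_upwards [ae_restrict_mem measurableSet_Ioi] with u hu
    refine ((integrableOn_pow_mul_exp_neg_mul k (ha.trans_lt hu)).const_mul (f u)).congr
      (ae_of_all _ fun s => ?_)
    ring_nf
  · refine (hint.norm.const_mul (k ! : ℝ)).congr ?_
    filter_upwards [ae_restrict_mem measurableSet_Ioi] with u hu
    have hu_pos : 0 < u := ha.trans_lt hu
    rw [norm_div, Real.norm_of_nonneg (pow_nonneg hu_pos.le (k + 1)),
      ← integral_pow_mul_mul_exp_neg_mul k ‖f u‖ hu_pos]
    refine setIntegral_congr_fun measurableSet_Ioi fun s hs => ?_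
    simp only [norm_mul, Real.norm_of_nonneg (pow_nonneg (le_of_lt hs) k),
      Real.norm_of_nonneg (Real.exp_pos _).le]

section Moments

variable {h : ℕ}

theorem integrableOn_buchstab_div_pow (hh : 2 ≤ h) :
    IntegrableOn (fun u => buchstab u / u ^ h) (Set.Ioi 1) := by
  have hpow : IntegrableOn (fun u : ℝ => u ^ (-(h : ℝ))) (Set.Ioi 1) :=
    integrableOn_Ioi_rpow_of_lt (by linarith [Nat.ofNat_le_cast (α := ℝ).2 hh]) one_pos
  refine (Integrable.bdd_mul hpow continuous_buchstab.aestronglyMeasurable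
    (ae_of_all _ norm_buchstab_le_one)).congr ?_
  filter_upwards [ae_restrict_mem measurableSet_Ioi] with u hu
  rw [Real.rpow_neg (zero_le_one.trans (le_of_lt hu)), Real.rpow_natCast, div_eq_mul_inv]

theorem mul_buchstab_div_pow_succ (h : ℕ) {u : ℝ} (hu : u ≠ 0) :
    u * buchstab u / u ^ (h + 1) = buchstab u / u ^ h := by
  rw [pow_succ', mul_div_mul_left _ _ hu]

theorem integrable_prod_pow_mul_buchstab (hh : 2 ≤ h) :
    Integrable (fun p : ℝ × ℝ => p.1 ^ h * (p.2 * buchstab p.2 * Real.exp (-p.1 * p.2)))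
      ((volume.restrict (Set.Ioi 0)).prod (volume.restrict (Set.Ioi 1))) := by
  refine integrable_prod_pow_mul_mul_exp_neg_mul zero_le_one h (f := fun u => u * buchstab u)
    (continuous_id.mul continuous_buchstab).aestronglyMeasurable ?_
  refine (integrableOn_buchstab_div_pow hh).congr_fun (fun u hu => ?_) measurableSet_Ioi
  exact (mul_buchstab_div_pow_succ h (zero_lt_one.trans hu).ne').symm

theorem integrableOn_pow_mul_exp_expIntegral_sub (hh : 2 ≤ h) :
    IntegrableOn (fun x : ℝ => x ^ (h - 1) * Real.exp (expIntegral x - x)) (Set.Ioi 0) := by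
  refine (integrable_prod_pow_mul_buchstab hh).integral_prod_left.congr ?_
  filter_upwards [ae_restrict_mem measurableSet_Ioi] with s hs
  rw [pow_mul_exp_expIntegral_sub (h - 1) hs, Nat.sub_add_cancel (by omega)]

theorem shortestCycleConst_eq (hh : 2 ≤ h) :
    shortestCycleConst h = h * ∫ u in Set.Ioi (1 : ℝ), buchstab u / u ^ h := by
  have hinner : ∀ s ∈ Set.Ioi (0 : ℝ), s ^ (h - 1) * Real.exp (expIntegral s - s) =
      ∫ u in Set.Ioi (1 : ℝ), s ^ h * (u * buchstab u * Real.exp (-s * u)) := fun s hs => by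
    rw [pow_mul_exp_expIntegral_sub (h - 1) hs, Nat.sub_add_cancel (by omega)]
  have houter : ∀ u ∈ Set.Ioi (1 : ℝ),
      ∫ s in Set.Ioi (0 : ℝ), s ^ h * (u * buchstab u * Real.exp (-s * u)) =
        h ! * (buchstab u / u ^ h) := fun u hu => by
    have hu_pos : 0 < u := zero_lt_one.trans hu
    rw [integral_pow_mul_mul_exp_neg_mul h _ hu_pos, mul_buchstab_div_pow_succ h hu_pos.ne']
  have hfactorial : (h ! : ℝ) = h * (h - 1)! := by
    rw [← Nat.cast_mul, Nat.mul_factorial_pred (by omega)]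
  have hfactorial_ne : ((h - 1)! : ℝ) ≠ 0 := Nat.cast_ne_zero.2 (Nat.factorial_ne_zero _)
  rw [shortestCycleConst, setIntegral_congr_fun measurableSet_Ioi hinner,
    integral_integral_swap (integrable_prod_pow_mul_buchstab hh),
    setIntegral_congr_fun measurableSet_Ioi houter, integral_const_mul, hfactorial]
  field_simp

end Moments

/-! ### Moments of the shortest cycle length -/

theorem integral_pow_mul_comp_ceil (f : ℕ → ℝ) (k : ℕ) {n : ℕ} (hn : 0 < n) :
    ∫ y in (0 : ℝ)..1, ((k : ℝ) + 1) * y ^ k * f ⌈y * n⌉₊ =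
      (∑ i ∈ Finset.range n, (((i : ℝ) + 1) ^ (k + 1) - (i : ℝ) ^ (k + 1)) * f (i + 1)) /
        (n : ℝ) ^ (k + 1) := by
  have hn' : (0 : ℝ) < n := Nat.cast_pos.2 hn
  have hceil (i : ℕ) : Set.EqOn (fun y : ℝ => ((k : ℝ) + 1) * y ^ k * f (i + 1))
      (fun y : ℝ => ((k : ℝ) + 1) * y ^ k * f ⌈y * n⌉₊)
      (Set.uIoc (i / n : ℝ) ((i + 1 : ℕ) / n : ℝ)) := fun y hy => by
    rw [Set.uIoc_of_le (by gcongr; omega), Set.mem_Ioc, div_lt_iff₀ hn', le_div_iff₀ hn'] at hy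
    have hceil_eq : ⌈y * n⌉₊ = i + 1 := (Nat.ceil_eq_iff i.succ_ne_zero).2 hy
    simp only [hceil_eq]
  have hcont (c : ℝ) : Continuous fun y : ℝ => ((k : ℝ) + 1) * y ^ k * c := by fun_prop
  have hsum := intervalIntegral.sum_integral_adjacent_intervals (a := fun i : ℕ => (i / n : ℝ))
    fun i (_ : i < n) => ((hcont (f (i + 1))).intervalIntegrable (μ := volume) _ _).congr (hceil i)
  rw [Nat.cast_zero, zero_div, div_self hn'.ne'] at hsum
  rw [← hsum, Finset.sum_div]
  refine Finset.sum_congr rfl fun i _ => ?_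
  rw [← intervalIntegral.integral_congr_ae (ae_of_all _ (hceil i)),
    intervalIntegral.integral_mul_const, intervalIntegral.integral_const_mul, integral_pow,
    mul_div_cancel₀ _ (by positivity : (k : ℝ) + 1 ≠ 0), div_pow, div_pow, ← sub_div,
    div_mul_eq_mul_div, Nat.cast_succ]

theorem setIntegral_Ioi_one_eq_intervalIntegral_comp_inv (f : ℝ → ℝ) :
    ∫ u in Set.Ioi (1 : ℝ), f u = ∫ y in (0 : ℝ)..1, (y ^ 2)⁻¹ * f y⁻¹ := by
  have himage : (fun y : ℝ => y⁻¹) '' Set.Ioo 0 1 = Set.Ioi 1 := by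
    rw [Set.image_inv_eq_inv, Set.inv_Ioo_0_left one_pos, inv_one]
  rw [← himage, integral_image_eq_integral_abs_deriv_smul measurableSet_Ioo
      (fun y hy => (hasDerivAt_inv hy.1.ne').hasDerivWithinAt) inv_injective.injOn,
    intervalIntegral.integral_of_le zero_le_one, integral_Ioc_eq_integral_Ioo]
  refine integral_congr_ae (ae_of_all _ fun y => ?_)
  dsimp only
  rw [abs_neg, abs_of_nonneg (inv_nonneg.2 (sq_nonneg y)), smul_eq_mul]

theorem shortestCycleConst_succ_eq_intervalIntegral {k : ℕ} (hk : 1 ≤ k) :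
    shortestCycleConst (k + 1) =
      ∫ y in (0 : ℝ)..1, ((k : ℝ) + 1) * y ^ k * (y⁻¹ * buchstab y⁻¹) := by
  rw [shortestCycleConst_eq (by omega), setIntegral_Ioi_one_eq_intervalIntegral_comp_inv,
    ← intervalIntegral.integral_const_mul]
  refine intervalIntegral.integral_congr_ae (ae_of_all _ fun y hy => ?_)
  rw [Set.uIoc_of_le zero_le_one] at hy
  have hy_pos : 0 < y := hy.1
  rw [Nat.cast_succ, inv_pow, div_inv_eq_mul, pow_succ]
  generalize buchstab y⁻¹ = w
  field_simp
  ring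

section RescaledIndex

variable {y : ℝ}

theorem tendsto_natCast_div_natCeil_mul (hy : 0 < y) :
    Tendsto (fun n : ℕ => (n / ⌈y * n⌉₊ : ℝ)) atTop (𝓝 y⁻¹) := by
  have hceil := ((tendsto_nat_ceil_mul_div_atTop hy.le).comp
    (tendsto_natCast_atTop_atTop (R := ℝ))).inv₀ hy.ne'
  simpa only [Function.comp_def, inv_div] using hceil

theorem tendsto_natCeil_mul_longCycleProb (hy : 0 < y) (hy₁ : y ≤ 1) :
    Tendsto (fun n : ℕ => ⌈y * n⌉₊ * longCycleProb ⌈y * n⌉₊ n) atTop (𝓝 (buchstab y⁻¹)) := by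
  have hratio := tendsto_natCast_div_natCeil_mul hy
  have herror : Tendsto (fun n : ℕ => (n / (⌈y * n⌉₊ : ℝ) ^ 2)) atTop (𝓝 0) := by
    have hceil : Tendsto (fun n : ℕ => (⌈y * n⌉₊ : ℝ)) atTop atTop :=
      tendsto_natCast_atTop_atTop.comp (tendsto_nat_ceil_atTop.comp
        (tendsto_natCast_atTop_atTop.const_mul_atTop hy))
    simpa only [div_div, ← sq] using hratio.div_atTop hceil
  refine ((continuous_buchstab.tendsto _).comp hratio).congr_dist
    (squeeze_zero' (Eventually.of_forall fun n => dist_nonneg) ?_ herror)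
  filter_upwards [eventually_gt_atTop 0] with n hn
  have hn' : (0 : ℝ) < n := Nat.cast_pos.2 hn
  rw [dist_comm]
  exact dist_mul_longCycleProb_buchstab_le (Nat.ceil_pos.2 (mul_pos hy hn'))
    (Nat.ceil_le.2 (mul_le_of_le_one_left hn'.le hy₁))

theorem tendsto_mul_longCycleProb_natCeil (hy : 0 < y) (hy₁ : y ≤ 1) :
    Tendsto (fun n : ℕ => n * longCycleProb ⌈y * n⌉₊ n) atTop (𝓝 (y⁻¹ * buchstab y⁻¹)) := by
  refine ((tendsto_natCast_div_natCeil_mul hy).mul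
    (tendsto_natCeil_mul_longCycleProb hy hy₁)).congr' ?_
  filter_upwards [eventually_gt_atTop 0] with n hn
  have hceil : (⌈y * n⌉₊ : ℝ) ≠ 0 :=
    Nat.cast_ne_zero.2 (Nat.ceil_pos.2 (mul_pos hy (Nat.cast_pos.2 hn))).ne'
  rw [← mul_assoc, div_mul_cancel₀ _ hceil]

theorem norm_mul_longCycleProb_natCeil_le (hy : 0 < y) (n : ℕ) :
    ‖n * longCycleProb ⌈y * n⌉₊ n‖ ≤ y⁻¹ := by
  rcases n.eq_zero_or_pos with rfl | hn
  · simpa using hy.le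
  have hyn : 0 < y * n := mul_pos hy (Nat.cast_pos.2 hn)
  rw [Real.norm_of_nonneg (mul_nonneg n.cast_nonneg (longCycleProb_nonneg _ _))]
  calc n * longCycleProb ⌈y * n⌉₊ n ≤ n * (⌈y * n⌉₊ : ℝ)⁻¹ := by
        gcongr
        exact longCycleProb_le_inv (Nat.ceil_pos.2 hyn) hn
    _ ≤ n * (y * n)⁻¹ := by
        gcongr
        exact Nat.le_ceil _
    _ = y⁻¹ := by field_simp

end RescaledIndex

theorem tendsto_integral_pow_mul_longCycleProb_natCeil {k : ℕ} (hk : 1 ≤ k) :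
    Tendsto (fun n : ℕ => ∫ y in (0 : ℝ)..1,
        ((k : ℝ) + 1) * y ^ k * (n * longCycleProb ⌈y * n⌉₊ n)) atTop
      (𝓝 (∫ y in (0 : ℝ)..1, ((k : ℝ) + 1) * y ^ k * (y⁻¹ * buchstab y⁻¹))) := by
  refine intervalIntegral.tendsto_integral_filter_of_dominated_convergence
    (fun _ => (k : ℝ) + 1) (Eventually.of_forall fun n => ?_)
    (Eventually.of_forall fun n => ae_of_all _ fun y hy => ?_) intervalIntegrable_const
    (ae_of_all _ fun y hy => ?_)
  · have hprob : Measurable fun y : ℝ => longCycleProb ⌈y * n⌉₊ n :=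
      (measurable_from_nat (f := fun m => longCycleProb m n)).comp
        (Nat.measurable_ceil.comp (measurable_id.mul_const (n : ℝ)))
    exact Measurable.aestronglyMeasurable (by fun_prop)
  · rw [Set.uIoc_of_le zero_le_one] at hy
    have hy_pos : 0 < y := hy.1
    rw [norm_mul, Real.norm_of_nonneg (by positivity), mul_assoc]
    refine mul_le_of_le_one_right (by positivity) ?_
    calc y ^ k * ‖n * longCycleProb ⌈y * n⌉₊ n‖ ≤ y * y⁻¹ := by
          gcongr
          exacts [pow_le_of_le_one hy_pos.le hy.2 (by omega),
            norm_mul_longCycleProb_natCeil_le hy_pos n]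
      _ = 1 := mul_inv_cancel₀ hy_pos.ne'
  · rw [Set.uIoc_of_le zero_le_one] at hy
    exact (tendsto_mul_longCycleProb_natCeil hy.1 hy.2).const_mul _

theorem tendsto_sum_pow_sub_pow_mul_longCycleProb {h : ℕ} (hh : 2 ≤ h) :
    Tendsto (fun n : ℕ => (∑ i ∈ Finset.range n,
        (((i : ℝ) + 1) ^ h - (i : ℝ) ^ h) * longCycleProb (i + 1) n) / (n : ℝ) ^ (h - 1)) atTop
      (𝓝 (shortestCycleConst h)) := by
  obtain ⟨k, rfl⟩ := Nat.exists_eq_succ_of_ne_zero (by omega : h ≠ 0)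
  rw [Nat.succ_eq_add_one, Nat.add_sub_cancel,
    shortestCycleConst_succ_eq_intervalIntegral (by omega)]
  refine (tendsto_integral_pow_mul_longCycleProb_natCeil (by omega)).congr' ?_
  filter_upwards [eventually_gt_atTop 0] with n hn
  rw [integral_pow_mul_comp_ceil (fun m => n * longCycleProb m n) k hn, pow_succ (n : ℝ) k,
    ← div_div, div_right_comm, Finset.sum_div]
  congr 1
  refine Finset.sum_congr rfl fun i _ => ?_
  rw [mul_left_comm, mul_div_cancel_left₀ _ (Nat.cast_ne_zero.2 hn.ne')]

theorem tendsto_longCycleProb_two : Tendsto (longCycleProb 2) atTop (𝓝 (Real.exp (-1))) := by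
  simpa [harmonic] using tendsto_longCycleProb 1

theorem tendsto_shortestCycleMoment_div {h : ℕ} (hh : 0 < h) {g : ℕ → ℝ} {c : ℝ}
    (hg : Tendsto g atTop atTop)
    (hc : Tendsto (fun n : ℕ => (∑ i ∈ Finset.range n,
      (((i : ℝ) + 1) ^ h - (i : ℝ) ^ h) * longCycleProb (i + 1) n) / g n) atTop (𝓝 c)) :
    Tendsto (fun n : ℕ => shortestCycleMoment h n / g n) atTop (𝓝 (Real.exp 1 * c)) := by
  have hcorrection := (tendsto_longCycleProb_two.const_sub 1).div_atTop hg
  have hlim := (hc.sub hcorrection).div tendsto_longCycleProb_two (Real.exp_pos _).ne'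
  rw [sub_zero, Real.exp_neg, div_inv_eq_mul, mul_comm] at hlim
  refine hlim.congr' ?_
  filter_upwards [eventually_gt_atTop 0] with n hn
  rw [shortestCycleMoment_eq hh hn, Pi.div_apply, ← sub_div, div_right_comm]

theorem tendsto_shortestCycleMoment_one :
    Tendsto (fun n : ℕ => shortestCycleMoment 1 n / Real.log n) atTop
      (𝓝 (Real.exp (1 - Real.eulerMascheroniConstant))) := by
  rw [sub_eq_add_neg, Real.exp_add]
  refine tendsto_shortestCycleMoment_div one_pos tendsto_log_natCast_atTop ?_
  simpa only [pow_one, add_sub_cancel_left, one_mul] using tendsto_sum_longCycleProb_div_log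

theorem tendsto_shortestCycleMoment {h : ℕ} (hh : 2 ≤ h) :
    Tendsto (fun n : ℕ => shortestCycleMoment h n / (n : ℝ) ^ (h - 1)) atTop
      (𝓝 (Real.exp 1 * shortestCycleConst h)) :=
  tendsto_shortestCycleMoment_div (by omega)
    ((tendsto_pow_atTop (by omega)).comp tendsto_natCast_atTop_atTop)
    (tendsto_sum_pow_sub_pow_mul_longCycleProb hh)

theorem eventually_nonempty_derangements :
    ∀ᶠ n : ℕ in atTop, (derangements (Fin n)).Nonempty := by
  filter_upwards [eventually_gt_atTop 0,
    tendsto_longCycleProb_two.eventually_ne (Real.exp_pos _).ne'] with n hn hprob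
  have hcard : (Fintype.card (derangements (Fin n)) : ℝ) ≠ 0 := by
    rw [card_derangements_eq_mul_longCycleProb hn]
    exact mul_ne_zero (Nat.cast_ne_zero.2 n.factorial_ne_zero) hprob
  exact Set.nonempty_coe_sort.1 (Fintype.card_pos_iff.1 (Nat.cast_ne_zero.1 hcard).bot_lt)

theorem tendsto_shortestCycleVariance :
    Tendsto (fun n : ℕ => shortestCycleVariance n / (n : ℝ)) atTop
      (𝓝 (Real.exp 1 * shortestCycleConst 2)) := by
  have hlog : Tendsto (fun n : ℕ => Real.log n ^ 2 / (n : ℝ)) atTop (𝓝 0) :=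
    (Real.isLittleO_pow_log_id_atTop (n := 2)).tendsto_div_nhds_zero.comp
      tendsto_natCast_atTop_atTop
  have hmean_sq := (tendsto_shortestCycleMoment_one.pow 2).mul hlog
  have hlim := (tendsto_shortestCycleMoment le_rfl).sub hmean_sq
  rw [mul_zero, sub_zero] at hlim
  refine hlim.congr' ?_
  filter_upwards [tendsto_log_natCast_atTop.eventually_gt_atTop 0,
    eventually_nonempty_derangements] with n hlog_pos hn
  rw [shortestCycleVariance_eq hn, div_pow, div_mul_div_cancel₀ (pow_pos hlog_pos 2).ne', sub_div,
    Nat.add_one_sub_one, pow_one]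

theorem mainTheorem3 :
    Filter.Tendsto (fun n : ℕ => shortestCycleMoment 1 n / Real.log (n : ℝ)) Filter.atTop
      (nhds (Real.exp (1 - Real.eulerMascheroniConstant))) ∧
    (∀ h : ℕ, 2 ≤ h →
      MeasureTheory.IntegrableOn
        (fun x : ℝ => x ^ (h - 1) * Real.exp (expIntegral x - x)) (Set.Ioi 0) ∧
      Filter.Tendsto (fun n : ℕ => shortestCycleMoment h n / (n : ℝ) ^ (h - 1)) Filter.atTop
        (nhds (Real.exp 1 * shortestCycleConst h))) ∧
    Filter.Tendsto (fun n : ℕ => shortestCycleVariance n / (n : ℝ)) Filter.atTop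
      (nhds (Real.exp 1 * shortestCycleConst 2)) :=
  ⟨tendsto_shortestCycleMoment_one,
    fun _ hh => ⟨integrableOn_pow_mul_exp_expIntegral_sub hh, tendsto_shortestCycleMoment hh⟩,
    tendsto_shortestCycleVariance⟩
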